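/- **Setting.** Let $\ell_1,\dots,\ell_N:\mathbb R^d\to\mathbb R$ be (measurable) per-example losses, let $S_1,\dots,S_M\subseteq\{1,\dots,N\}$ be nonempty candidate subsets ($M\ge 1$), let $j^*$ be uniform on $\{1,\dots,M\}$, and let $S^*=S_{j^*}$ be the secret subset. Fix a perturbation scale $\mu>0$, a clipping threshold $c>0$, step sizes $\eta_t\in\mathbb R$, a weight decay $\lambda\in\mathbb R$, initial parameters $\theta_1\in\mathbb R^d$, a number of rounds $T$ and a total budget $\mathrm{MI}_{\mathrm{tot}}>0$. Information is measured in nats, and $\operatorname{sign}$ takes values in $\{-1,+1\}$ with $\operatorname{sign}(0)=+1$. For $\sigma>0$ let $\phi_\sigma$ be the density of $\mathcal N(0,\sigma^2)$. For $q\in(0,1)$ let $$I_{\mathrm{BG}}(q,\sigma)=q\int\phi_\sigma(y-1)\log\frac{\phi_\sigma(y-1)}{q\phi_\sigma(y-1)+(1-q)\phi_\sigma(y+1)}\,dy+(1-q)\int\phi_\sigma(y+1)\log\frac{\phi_\sigma(y+1)}{q\phi_\sigma(y-1)+(1-q)\phi_\sigma(y+1)}\,dy$$ be the mutual information between a sign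 $\xi$ with $P(\xi=+1)=q$ and $\xi+\mathcal N(0,\sigma^2)$, and let $\mathrm{BinaryMI}^{-1}(q,\beta)$ be the $\sigma>0$ with $I_{\mathrm{BG}}(q,\sigma)=\beta$. Let $h(q)=-q\log q-(1-q)\log(1-q)$. **Algorithm.** Start with $p_1[m]=1/M$ for all $m$. At step $t=1,\dots,T$: 1. Sample $z_t\sim\mathcal N(0,I_d)$. For every $i$ compute $g_i=\frac{\ell_i(\theta_t+\mu z_t)-\ell_i(\theta_t-\mu z_t)}{2\mu}$ and let $\hat g_i$ be $g_i$ clipped to $[-c,c]$. For every $m$ let $s_m=\operatorname{sign}\big(\frac1{|S_m|}\sum_{i\in S_m}\hat g_i\big)$. Let $q_t^+=\sum_m p_t[m]\,\mathbf 1[s_m=+1]$. 2. Set $$\beta_t=\min\Big(\frac{\max\big(0,\ \mathrm{MI}_{\mathrm{tot}}-\sum_{\tau<t}\beta_\tau^{\mathrm{used}}\big)}{T-t+1},\ 0.999\,h(q_t^+)\Big).$$ 3. If $q_t^+\in\{0,1\}$ (unanimity), set $\sigma_t=0$, $\tilde Y_t=s_{j^*}$, $\beta_t^{\mathrm{used}}=0$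 and $p_{t+1}=p_t$. Otherwise (disagreement), set $\sigma_t=\mathrm{BinaryMI}^{-1}(q_t^+,\beta_t)$, $\tilde Y_t=s_{j^*}+\mathcal N(0,\sigma_t^2)$, $\beta_t^{\mathrm{used}}=\beta_t$ and $p_{t+1}[m]\propto p_t[m]\,\phi_{\sigma_t}(\tilde Y_t-s_m)$. 4. Release $Y_t=\operatorname{sign}(\tilde Y_t)$ and set $\theta_{t+1}=(1-\eta_t\lambda)\theta_t-\eta_tY_tz_t$. The directions $z_t$, the Gaussian noises and $j^*$ are all independent. **Theorem 1 (PACZero-MI privacy).** The released bits $Y_{1:T}=(Y_1,\dots,Y_T)$ are measurable functions of the randomness (up to null sets), and $$I(S^*;\,Y_{1:T})\ \le\ \mathrm{MI}_{\mathrm{tot}}.$$ -/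

import Mathlib

open MeasureTheory ProbabilityTheory
open scoped ENNReal NNReal

noncomputable section

namespace PACZero

/-- Mutual information `I(X; Y)` (in nats) of two random variables on `(Ω, P)`: the Kullback-Leibler
divergence of their joint law from the product of their marginal laws. -/
def mutualInfo {Ω α β : Type*} [MeasurableSpace Ω] [MeasurableSpace α] [MeasurableSpace β]
    (X : Ω → α) (Y : Ω → β) (P : Measure Ω) : ℝ≥0∞ :=
  InformationTheory.klDiv (P.map fun ω => (X ω, Y ω)) ((P.map X).prod (P.map Y))

/-- The sign with values in `{-1, +1}` and the convention `sign 0 = +1`. -/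
def sgn (x : ℝ) : ℝ := if 0 ≤ x then 1 else -1

/-- The density `φ_σ` of the centred Gaussian distribution with standard deviation `σ`. -/
def phi (σ y : ℝ) : ℝ := gaussianPDFReal 0 (Real.toNNReal (σ ^ 2)) y

/-- The mutual information (in nats) of the binary-input Gaussian channel: `I(ξ; ξ + N)` for
`ξ ∈ {-1, +1}` with `P(ξ = +1) = q` and an independent noise `N ∼ 𝒩(0, σ²)`. -/
def binaryMI (q σ : ℝ) : ℝ :=
  q * (∫ y, phi σ (y - 1) *
      Real.log (phi σ (y - 1) / (q * phi σ (y - 1) + (1 - q) * phi σ (y + 1))))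
  + (1 - q) * (∫ y, phi σ (y + 1) *
      Real.log (phi σ (y + 1) / (q * phi σ (y - 1) + (1 - q) * phi σ (y + 1))))

/-- The calibrated noise level: the `σ > 0` that solves `binaryMI q σ = β`. -/
def binaryMIInv (q β : ℝ) : ℝ := sInf {σ : ℝ | 0 < σ ∧ binaryMI q σ = β}

/-- The public parameters of a run: dimension `d`, `N` training examples, `M` candidate subsets. -/
structure Config (d N M : ℕ) where
  /-- the per-example losses `ℓ_i` -/
  loss : Fin N → EuclideanSpace ℝ (Fin d) → ℝ
  /-- the candidate subsets `S_1, …, S_M` of the universe of training examples -/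
  subset : Fin M → Finset (Fin N)
  /-- the perturbation scale `μ` -/
  mu : ℝ
  /-- the clipping threshold `c` -/
  clip : ℝ
  /-- the step sizes `η_t` -/
  eta : ℕ → ℝ
  /-- the weight decay `λ` -/
  lam : ℝ
  /-- the initial parameters -/
  theta0 : EuclideanSpace ℝ (Fin d)
  /-- the number `T` of rounds -/
  rounds : ℕ
  /-- the total mutual information budget `MI_tot`, in nats -/
  budget : ℝ

/-- The state of the algorithm before a step: the parameters `θ_t`, the posterior `p_t` over the
secret index, and the budget consumed in the earlier steps. -/
structure State (d M : ℕ) where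
  theta : EuclideanSpace ℝ (Fin d)
  post : Fin M → ℝ
  used : ℝ

namespace Config

variable {d N M : ℕ} (C : Config d N M)

/-- The clipped two-point finite difference `ĝ_i` of example `i` at `θ` in the direction `z`. -/
def zoScalar (θ z : EuclideanSpace ℝ (Fin d)) (i : Fin N) : ℝ :=
  let g := (C.loss i (θ + C.mu • z) - C.loss i (θ - C.mu • z)) / (2 * C.mu)
  Real.sign g * min |g| C.clip

/-- The sign `s_m` of the mean of the `ĝ_i` over the subset `S_m`. -/
def subsetSign (θ z : EuclideanSpace ℝ (Fin d)) (m : Fin M) : ℝ :=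
  sgn ((1 / ((C.subset m).card : ℝ)) * ∑ i ∈ C.subset m, C.zoScalar θ z i)

open Classical in
/-- The posterior probability `q_t⁺` of the sign `+1`. -/
def agreeProb (st : State d M) (z : EuclideanSpace ℝ (Fin d)) : ℝ :=
  ∑ m, st.post m * (if C.subsetSign st.theta z m = 1 then 1 else 0)

/-- The unanimity test `q_t⁺ ∈ {0, 1}`. -/
def Unanimous (st : State d M) (z : EuclideanSpace ℝ (Fin d)) : Prop :=
  C.agreeProb st z = 0 ∨ C.agreeProb st z = 1

/-- The budget of a step under adaptive allocation, with the feasibility cap `0.999 h(q_t⁺)`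
(`h` is the binary entropy in nats). Steps are numbered `t = 0, …, T - 1` here, so that
`T - t` is the number of remaining steps, the current one included. -/
def stepBudget (t : ℕ) (st : State d M) (z : EuclideanSpace ℝ (Fin d)) : ℝ :=
  min (max 0 (C.budget - st.used) / ((C.rounds : ℝ) - t))
    (0.999 * Real.binEntropy (C.agreeProb st z))

open Classical in
/-- The noise level `σ_t`. -/
def noiseLevel (t : ℕ) (st : State d M) (z : EuclideanSpace ℝ (Fin d)) : ℝ :=
  if C.Unanimous st z then 0 else binaryMIInv (C.agreeProb st z) (C.stepBudget t st z)

/-- The pre-quantized release `Ỹ_t = s_j + σ_t g`, for the secret index `j` and a standard normal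
variable `g`. On the unanimity branch `σ_t = 0`, so that it is `s_j`. -/
def release (j : Fin M) (t : ℕ) (st : State d M) (z : EuclideanSpace ℝ (Fin d)) (g : ℝ) : ℝ :=
  C.subsetSign st.theta z j + C.noiseLevel t st z * g

/-- The released bit `Y_t = sign Ỹ_t`. -/
def bit (j : Fin M) (t : ℕ) (st : State d M) (z : EuclideanSpace ℝ (Fin d)) (g : ℝ) : ℝ :=
  sgn (C.release j t st z g)

open Classical in
/-- The posterior `p_{t+1}` after the (real-valued) release `y`: unchanged on the unanimity branch,
`p_{t+1}[m] ∝ p_t[m] 𝒩(y; s_m, σ_t²)` on the disagreement branch. -/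
def nextPost (t : ℕ) (st : State d M) (z : EuclideanSpace ℝ (Fin d)) (y : ℝ) : Fin M → ℝ :=
  if C.Unanimous st z then st.post else fun m =>
    st.post m * phi (C.noiseLevel t st z) (y - C.subsetSign st.theta z m) /
      ∑ k, st.post k * phi (C.noiseLevel t st z) (y - C.subsetSign st.theta z k)

open Classical in
/-- One step of the algorithm with secret index `j`, direction `z` and standard normal noise `g`. -/
def step (j : Fin M) (t : ℕ) (z : EuclideanSpace ℝ (Fin d)) (g : ℝ) (st : State d M) :
    State d M where
  theta := (1 - C.eta t * C.lam) • st.theta - (C.eta t * C.bit j t st z g) • z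
  post := C.nextPost t st z (C.release j t st z g)
  used := st.used + if C.Unanimous st z then 0 else C.stepBudget t st z

/-- The state before the step number `t` (after `t` steps), for the secret index `j`, the directions
`z` and the standard normal variables `g`. The run starts with the uniform prior. -/
def state (j : Fin M) (z : Fin C.rounds → EuclideanSpace ℝ (Fin d)) (g : Fin C.rounds → ℝ) :
    (t : ℕ) → t ≤ C.rounds → State d M
  | 0, _ => ⟨C.theta0, fun _ => 1 / (M : ℝ), 0⟩
  | t + 1, h => C.step j t (z ⟨t, h⟩) (g ⟨t, h⟩) (state j z g t (Nat.le_of_succ_le h))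

/-- The released bits `Y_{1:T}` of a complete run. -/
def bits (j : Fin M) (z : Fin C.rounds → EuclideanSpace ℝ (Fin d)) (g : Fin C.rounds → ℝ) :
    Fin C.rounds → ℝ :=
  fun t => C.bit j t (C.state j z g t t.isLt.le) (z t) (g t)

/-- The joint law of the randomness of a run: a uniform secret index, `T` standard Gaussian
directions in `ℝ^d`, and `T` standard normal noise variables, all independent. -/
def randomnessLaw : Measure (Fin M × (Fin C.rounds → EuclideanSpace ℝ (Fin d)) ×
    (Fin C.rounds → ℝ)) :=
  (uniformOn (Set.univ : Set (Fin M))).prod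
    ((Measure.pi fun _ => stdGaussian (EuclideanSpace ℝ (Fin d))).prod
      (Measure.pi fun _ => gaussianReal 0 1))

end Config

end PACZero

end

open Filter Topology

namespace PACZero

/-! The proof establishes the bound for a richer transcript: all directions, the final state (which
includes the exact posterior) and the released bits. Data processing then passes to `S*`, a function
of the secret index, and to the bits, a function of the transcript.

Two facts carry the argument. The first is Bayes' rule along the run: given the history, the secret
index has the law `post`. Hence the joint law of index and transcript has density `M * post` with
respect to the product of its marginals (`sum_lintegral_history`, `map_prodMk_transcript`), and the
divergence is the mean of `log M - entropy post`. The second is a conservation law: the mean of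
`entropy post + used` does not change (`sum_lintegral_entropy_history`). In a disagreement step the
posterior entropy drops on average by the information of the binary Gaussian channel, which the
calibration makes equal to the budget charged. In a unanimous step all candidates give the same
sign, and nothing is learnt or charged. The sum starts at `log M`, and `used` never exceeds the
budget, so the mean of `log M - entropy post` is at most the budget.

The rest is analysis: the calibration equation must be solvable (continuity of `binaryMI q` and its
limits `h(q)` at `0` and `0` at infinity), and its smallest solution must be measurable in `(q, β)`.
-/

/-! ### Logarithmic Gaussian mixtures: bounds, continuity, limits. -/

/-- The mean of `log (a + (1 - a) exp (-2 (x u + u ^ 2)))` for a standard normal variable `x`. -/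
noncomputable def gaussLogMix (a u : ℝ) : ℝ :=
  ∫ x, Real.log (a + (1 - a) * Real.exp (-2 * (x * u + u ^ 2))) ∂gaussianReal 0 1

lemma mix_exp_pos {a : ℝ} (ha : 0 < a) (ha1 : a < 1) (w : ℝ) : 0 < a + (1 - a) * Real.exp w := by
  have := Real.exp_pos w
  have : 0 < 1 - a := by linarith
  positivity

/-- The mixture is a convex combination of `1` and `exp w`, so its logarithm lies between `0` and
`w`. With `w` affine in `x`, this gives integrability against the Gaussian. -/
lemma log_mix_le {a : ℝ} (ha : 0 < a) (ha1 : a < 1) (w : ℝ) :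
    Real.log (a + (1 - a) * Real.exp w) ≤ max 0 w := by
  rw [Real.log_le_iff_le_exp (mix_exp_pos ha ha1 w)]
  have h1 : 1 ≤ Real.exp (max 0 w) := Real.one_le_exp (le_max_left _ _)
  have h2 : Real.exp w ≤ Real.exp (max 0 w) := Real.exp_le_exp.2 (le_max_right _ _)
  nlinarith

lemma le_log_mix {a : ℝ} (ha : 0 < a) (ha1 : a < 1) (w : ℝ) :
    min 0 w ≤ Real.log (a + (1 - a) * Real.exp w) := by
  rw [Real.le_log_iff_exp_le (mix_exp_pos ha ha1 w)]
  have h1 : Real.exp (min 0 w) ≤ 1 := Real.exp_le_one_iff.2 (min_le_left _ _)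
  have h2 : Real.exp (min 0 w) ≤ Real.exp w := Real.exp_le_exp.2 (min_le_right _ _)
  nlinarith

lemma log_le_log_mix {a : ℝ} (ha : 0 < a) (ha1 : a < 1) (w : ℝ) :
    Real.log a ≤ Real.log (a + (1 - a) * Real.exp w) := by
  have := Real.exp_pos w
  have : 0 < 1 - a := by linarith
  apply Real.log_le_log ha
  have : 0 < (1 - a) * Real.exp w := by positivity
  linarith

lemma abs_log_mix_le {a : ℝ} (ha : 0 < a) (ha1 : a < 1) (w : ℝ) :
    |Real.log (a + (1 - a) * Real.exp w)| ≤ |w| := by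
  have h1 := log_mix_le ha ha1 w
  have h2 := le_log_mix ha ha1 w
  rw [abs_le]
  constructor
  · exact le_trans (le_min (by simp) (neg_abs_le w)) h2
  · exact h1.trans (max_le (abs_nonneg w) (le_abs_self w))

lemma integrable_id_gaussian : Integrable (fun x : ℝ => x) (gaussianReal 0 1) := by
  exact (memLp_id_gaussianReal (μ := 0) (v := 1) 1).integrable (by simp)

lemma integrable_sq_gaussian : Integrable (fun x : ℝ => x ^ 2) (gaussianReal 0 1) := by
  simpa using (memLp_id_gaussianReal (μ := 0) (v := 1) 2).integrable_sq

lemma integrable_log_mix {a : ℝ} (ha : 0 < a) (ha1 : a < 1) (u : ℝ) :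
    Integrable (fun x : ℝ => Real.log (a + (1 - a) * Real.exp (-2 * (x * u + u ^ 2))))
      (gaussianReal 0 1) := by
  have : Integrable (fun x : ℝ => -2 * (x * u + u ^ 2)) (gaussianReal 0 1) :=
    ((integrable_id_gaussian.mul_const u).add (integrable_const _)).const_mul _
  refine this.norm.mono' (Measurable.aestronglyMeasurable (by fun_prop)) (ae_of_all _ fun x => ?_)
  exact abs_log_mix_le ha ha1 _

lemma continuous_gaussLogMix {a : ℝ} (ha : 0 < a) (ha1 : a < 1) : Continuous (gaussLogMix a) := by
  rw [continuous_iff_continuousAt]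
  intro u₀
  refine continuousAt_of_dominated
    (bound := fun x : ℝ => 2 * (|x| * (|u₀| + 1) + (|u₀| + 1) ^ 2)) ?_ ?_ ?_ ?_
  · exact Eventually.of_forall fun u => Measurable.aestronglyMeasurable (by fun_prop)
  · filter_upwards [Metric.ball_mem_nhds u₀ one_pos] with u hu
    refine ae_of_all _ fun x => ?_
    refine (abs_log_mix_le ha ha1 _).trans ?_
    have hu' : |u| ≤ |u₀| + 1 := by
      have h1 : |u - u₀| < 1 := by simpa [Real.dist_eq] using hu
      have := abs_sub_abs_le_abs_sub u u₀
      linarith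
    rw [abs_mul, abs_neg, abs_two]
    refine mul_le_mul_of_nonneg_left ((abs_add_le _ _).trans ?_) two_pos.le
    rw [abs_mul, abs_pow]
    gcongr
  · exact ((integrable_id_gaussian.abs.mul_const _).add (integrable_const _)).const_mul _
  · refine ae_of_all _ fun x => ContinuousAt.log (by fun_prop) (mix_exp_pos ha ha1 _).ne'

/-- For fixed `x` the exponential vanishes as `|u|` grows, leaving `log a`. A general filter is used
because the inputs `+1` and `-1` lead to `u → +∞` and `u → -∞` respectively. -/
lemma tendsto_gaussLogMix {a : ℝ} (ha : 0 < a) (ha1 : a < 1) {l : Filter ℝ}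
    [l.IsCountablyGenerated] (hl : Tendsto (fun u : ℝ => |u|) l atTop) :
    Tendsto (gaussLogMix a) l (𝓝 (Real.log a)) := by
  have hc : Real.log a = ∫ _x : ℝ, Real.log a ∂gaussianReal 0 1 := by simp
  rw [hc]
  refine tendsto_integral_filter_of_dominated_convergence
    (fun x : ℝ => |Real.log a| + x ^ 2 / 2) ?_ ?_ ?_ ?_
  · exact Eventually.of_forall fun u => Measurable.aestronglyMeasurable (by fun_prop)
  · refine Eventually.of_forall fun u => ae_of_all _ fun x => ?_
    have h1 := log_mix_le ha ha1 (-2 * (x * u + u ^ 2))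
    have h2 := log_le_log_mix ha ha1 (-2 * (x * u + u ^ 2))
    -- Domination uniform in `u`: completing the square, `-2 (x u + u ^ 2)` is largest at `u = -x /
    -- 2`, with value `x ^ 2 / 2`.
    have h3 : max 0 (-2 * (x * u + u ^ 2)) ≤ x ^ 2 / 2 :=
      max_le (by positivity) (by nlinarith [sq_nonneg (x + 2 * u)])
    have h4 := neg_abs_le (Real.log a)
    have h5 := abs_nonneg (Real.log a)
    have h6 := sq_nonneg x
    rw [Real.norm_eq_abs, abs_le]
    constructor <;> linarith
  · exact (integrable_const _).add (integrable_sq_gaussian.div_const _)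
  · refine ae_of_all _ fun x => ?_
    have h1 : Tendsto (fun u : ℝ => |u| * (|u| + -|x|)) l atTop :=
      hl.atTop_mul_atTop₀ (tendsto_atTop_add_const_right _ _ hl)
    have h2 : Tendsto (fun u : ℝ => x * u + u ^ 2) l atTop := by
      refine tendsto_atTop_mono (fun u => ?_) h1
      have := neg_abs_le (x * u)
      rw [abs_mul] at this
      nlinarith [sq_abs u]
    have h3 : Tendsto (fun u : ℝ => Real.exp (-2 * (x * u + u ^ 2))) l (𝓝 0) :=
      Real.tendsto_exp_atBot.comp (h2.const_mul_atTop_of_neg (by norm_num))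
    have h4 := (h3.const_mul (1 - a)).const_add a
    simp only [mul_zero, add_zero] at h4
    exact h4.log ha.ne'

lemma gaussLogMix_zero (a : ℝ) : gaussLogMix a 0 = 0 := by simp [gaussLogMix]

lemma measurable_gaussLogMix (u : ℝ) : Measurable fun a => gaussLogMix a u := by
  refine StronglyMeasurable.measurable ?_
  unfold gaussLogMix
  refine StronglyMeasurable.integral_prod_right (f := fun (a x : ℝ) =>
    Real.log (a + (1 - a) * Real.exp (-2 * (x * u + u ^ 2)))) ?_
  exact Measurable.stronglyMeasurable (by fun_prop)

/-! ### Gaussian densities -/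

lemma phi_eq (σ y : ℝ) :
    phi σ y = (Real.sqrt (2 * Real.pi * σ ^ 2))⁻¹ * Real.exp (-y ^ 2 / (2 * σ ^ 2)) := by
  simp [phi, gaussianPDFReal, Real.coe_toNNReal _ (sq_nonneg σ)]

lemma phi_pos {σ : ℝ} (hσ : 0 < σ) (y : ℝ) : 0 < phi σ y := by
  rw [phi_eq]; positivity

lemma measurable_phi : Measurable fun p : ℝ × ℝ => phi p.1 p.2 := by
  simp only [phi_eq]; fun_prop

lemma gaussianReal_map_affine (s σ : ℝ) :
    (gaussianReal 0 1).map (fun x => s + σ * x) = gaussianReal s (Real.toNNReal (σ ^ 2)) := by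
  have h1 : (gaussianReal 0 1).map (σ * ·) = gaussianReal 0 (Real.toNNReal (σ ^ 2)) := by
    rw [gaussianReal_map_const_mul]
    congr 1
    · simp
    · ext; simp [Real.coe_toNNReal _ (sq_nonneg σ)]
  have h2 : (fun x : ℝ => s + σ * x) = (s + ·) ∘ (σ * ·) := rfl
  rw [h2, ← Measure.map_map (by fun_prop) (by fun_prop), h1, gaussianReal_map_const_add, zero_add]

lemma gaussianPDFReal_eq_phi (s σ y : ℝ) :
    gaussianPDFReal s (Real.toNNReal (σ ^ 2)) y = phi σ (y - s) := by
  simp [phi, gaussianPDFReal]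

lemma lintegral_gaussian_affine {s σ : ℝ} (hσ : 0 < σ) {f : ℝ → ℝ≥0∞} (hf : Measurable f) :
    ∫⁻ x, f (s + σ * x) ∂gaussianReal 0 1 = ∫⁻ y, ENNReal.ofReal (phi σ (y - s)) * f y := by
  have hv : Real.toNNReal (σ ^ 2) ≠ 0 := by
    rw [Ne, Real.toNNReal_eq_zero, not_le]; positivity
  rw [← lintegral_map (f := f) (g := fun x => s + σ * x) hf (by fun_prop),
    gaussianReal_map_affine, gaussianReal_of_var_ne_zero _ hv,
    lintegral_withDensity_eq_lintegral_mul _ (measurable_gaussianPDF _ _) hf]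
  simp [gaussianPDF, gaussianPDFReal_eq_phi]

lemma integral_phi_mul {s σ : ℝ} (hσ : 0 < σ) (f : ℝ → ℝ) (hf : Measurable f) :
    ∫ y, phi σ (y - s) * f y = ∫ x, f (s + σ * x) ∂gaussianReal 0 1 := by
  have hv : Real.toNNReal (σ ^ 2) ≠ 0 := by
    rw [Ne, Real.toNNReal_eq_zero, not_le]; positivity
  rw [← integral_map (f := f) (φ := fun x => s + σ * x) (by fun_prop)
    hf.aestronglyMeasurable, gaussianReal_map_affine,
    integral_gaussianReal_eq_integral_smul hv]
  simp [gaussianPDFReal_eq_phi]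

/-- The likelihood ratio of the two inputs, seen from the true input `+1` at noise `x`; it has the
form occurring in `gaussLogMix` with `u = σ⁻¹`. The input `-1` corresponds to `u = -σ⁻¹`. -/
lemma phi_add_two {σ : ℝ} (hσ : 0 < σ) (x : ℝ) :
    phi σ (σ * x + 2) = phi σ (σ * x) * Real.exp (-2 * (x * σ⁻¹ + σ⁻¹ ^ 2)) := by
  rw [phi_eq, phi_eq, mul_assoc (Real.sqrt _)⁻¹, ← Real.exp_add]
  congr 2
  field_simp
  ring

lemma phi_sub_two {σ : ℝ} (hσ : 0 < σ) (x : ℝ) :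
    phi σ (σ * x - 2) = phi σ (σ * x) * Real.exp (-2 * (x * -σ⁻¹ + (-σ⁻¹) ^ 2)) := by
  rw [phi_eq, phi_eq, mul_assoc (Real.sqrt _)⁻¹, ← Real.exp_add]
  congr 2
  field_simp
  ring

/-- The density of the output of the binary channel. -/
noncomputable def mixDensity (q σ y : ℝ) : ℝ := q * phi σ (y - 1) + (1 - q) * phi σ (y + 1)

lemma log_phi_div_mixDensity_one {q σ : ℝ} (hσ : 0 < σ) (x : ℝ) :
    Real.log (phi σ (1 + σ * x - 1) / mixDensity q σ (1 + σ * x)) =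
      -Real.log (q + (1 - q) * Real.exp (-2 * (x * σ⁻¹ + σ⁻¹ ^ 2))) := by
  have h : mixDensity q σ (1 + σ * x) = phi σ (1 + σ * x - 1) *
      (q + (1 - q) * Real.exp (-2 * (x * σ⁻¹ + σ⁻¹ ^ 2))) := by
    have h1 : (1 + σ * x - 1) = σ * x := by ring
    have h2 : (1 + σ * x + 1) = σ * x + 2 := by ring
    rw [mixDensity, h1, h2, phi_add_two hσ]; ring
  rw [h, div_mul_eq_div_div, div_self (phi_pos hσ _).ne', one_div, Real.log_inv]

lemma log_phi_div_mixDensity_neg_one {q σ : ℝ} (hσ : 0 < σ) (x : ℝ) :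
    Real.log (phi σ (-1 + σ * x + 1) / mixDensity q σ (-1 + σ * x)) =
      -Real.log ((1 - q) + (1 - (1 - q)) * Real.exp (-2 * (x * -σ⁻¹ + (-σ⁻¹) ^ 2))) := by
  have h : mixDensity q σ (-1 + σ * x) = phi σ (-1 + σ * x + 1) *
      ((1 - q) + (1 - (1 - q)) * Real.exp (-2 * (x * -σ⁻¹ + (-σ⁻¹) ^ 2))) := by
    have h1 : (-1 + σ * x + 1) = σ * x := by ring
    have h2 : (-1 + σ * x - 1) = σ * x - 2 := by ring
    rw [mixDensity, h1, h2, phi_sub_two hσ]; ring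
  rw [h, div_mul_eq_div_div, div_self (phi_pos hσ _).ne', one_div, Real.log_inv]

/-- Substituting `y = ±1 + σ x` moves the whole dependence on `σ` from the density into the
integrand, where dominated convergence applies. -/
lemma binaryMI_eq {q σ : ℝ} (hσ : 0 < σ) :
    binaryMI q σ = -(q * gaussLogMix q σ⁻¹) - (1 - q) * gaussLogMix (1 - q) (-σ⁻¹) := by
  have hm : Measurable fun y => phi σ y :=
    measurable_phi.comp (by fun_prop : Measurable fun y : ℝ => (σ, y))
  have h1 := integral_phi_mul (s := 1) hσ
    (fun y => Real.log (phi σ (y - 1) / mixDensity q σ y)) (by unfold mixDensity; fun_prop)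
  have h2 := integral_phi_mul (s := -1) hσ
    (fun y => Real.log (phi σ (y + 1) / mixDensity q σ y)) (by unfold mixDensity; fun_prop)
  simp only [log_phi_div_mixDensity_one hσ, log_phi_div_mixDensity_neg_one hσ, sub_neg_eq_add,
    integral_neg] at h1 h2
  unfold binaryMI
  simp only [mixDensity] at h1 h2
  rw [h1, h2, gaussLogMix, gaussLogMix]
  ring

/-! ### Calibration of the noise -/

lemma continuousOn_binaryMI {q : ℝ} (hq : 0 < q) (hq1 : q < 1) :
    ContinuousOn (binaryMI q) (Set.Ioi 0) := by
  have : ContinuousOn (fun σ : ℝ => -(q * gaussLogMix q σ⁻¹)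
      - (1 - q) * gaussLogMix (1 - q) (-σ⁻¹)) (Set.Ioi 0) := by
    have hi : ContinuousOn (fun σ : ℝ => σ⁻¹) (Set.Ioi 0) :=
      continuousOn_inv₀.mono fun x hx => ne_of_gt hx
    have c1 := (continuous_gaussLogMix hq hq1).comp_continuousOn hi
    have c2 := (continuous_gaussLogMix (a := 1 - q) (by linarith) (by linarith)).comp_continuousOn
      hi.neg
    exact (c1.const_mul q).neg.sub (c2.const_mul _)
  exact this.congr fun σ hσ => binaryMI_eq hσ

lemma tendsto_binaryMI_zero {q : ℝ} (hq : 0 < q) (hq1 : q < 1) :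
    Tendsto (binaryMI q) (𝓝[>] 0) (𝓝 (Real.binEntropy q)) := by
  have l1 : Tendsto (fun σ : ℝ => gaussLogMix q σ⁻¹) (𝓝[>] 0) (𝓝 (Real.log q)) :=
    (tendsto_gaussLogMix hq hq1 tendsto_abs_atTop_atTop).comp tendsto_inv_nhdsGT_zero
  have l2 : Tendsto (fun σ : ℝ => gaussLogMix (1 - q) (-σ⁻¹)) (𝓝[>] 0) (𝓝 (Real.log (1 - q))) :=
    (tendsto_gaussLogMix (a := 1 - q) (by linarith) (by linarith) tendsto_abs_atBot_atTop).comp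
      (tendsto_neg_atTop_atBot.comp tendsto_inv_nhdsGT_zero)
  have := (l1.const_mul q).neg.sub (l2.const_mul (1 - q))
  have he : Real.binEntropy q = -(q * Real.log q) - (1 - q) * Real.log (1 - q) := by
    rw [Real.binEntropy, Real.log_inv, Real.log_inv]; ring
  rw [he]
  refine this.congr' ?_
  filter_upwards [self_mem_nhdsWithin] with σ hσ
  exact (binaryMI_eq hσ).symm

lemma tendsto_binaryMI_atTop {q : ℝ} (hq : 0 < q) (hq1 : q < 1) :
    Tendsto (binaryMI q) atTop (𝓝 0) := by
  have l1 : Tendsto (fun σ : ℝ => gaussLogMix q σ⁻¹) atTop (𝓝 0) := by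
    have := (continuous_gaussLogMix hq hq1).tendsto 0
    rw [gaussLogMix_zero] at this
    exact this.comp tendsto_inv_atTop_zero
  have l2 : Tendsto (fun σ : ℝ => gaussLogMix (1 - q) (-σ⁻¹)) atTop (𝓝 0) := by
    have := (continuous_gaussLogMix (a := 1 - q) (by linarith) (by linarith)).tendsto 0
    rw [gaussLogMix_zero] at this
    have hi := tendsto_inv_atTop_zero (𝕜 := ℝ).neg
    rw [neg_zero] at hi
    exact this.comp hi
  have := (l1.const_mul q).neg.sub (l2.const_mul (1 - q))
  simp only [mul_zero, neg_zero, sub_zero] at this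
  refine this.congr' ?_
  filter_upwards [eventually_gt_atTop 0] with σ hσ
  exact (binaryMI_eq hσ).symm

/-- The pairs `(q, β)` for which the calibration equation has a solution. -/
def calibrationRegion : Set (ℝ × ℝ) :=
  {p | 0 < p.1 ∧ p.1 < 1 ∧ 0 < p.2 ∧ p.2 < Real.binEntropy p.1}

/-- Near `0` the information is close to `h(q) > β`, so the intermediate value theorem yields a
solution below any point where it is at most `β`. This takes the place of monotonicity in `σ`. -/
lemma exists_binaryMI_eq_of_le {q β a : ℝ} (hq : 0 < q) (hq1 : q < 1)
    (hβ : β < Real.binEntropy q) (ha : 0 < a) (h : binaryMI q a ≤ β) :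
    ∃ σ, 0 < σ ∧ σ ≤ a ∧ binaryMI q σ = β := by
  have hev : ∀ᶠ σ in 𝓝[>] (0 : ℝ), β < binaryMI q σ ∧ 0 < σ ∧ σ < a :=
    ((tendsto_binaryMI_zero hq hq1).eventually_const_lt hβ).and
      ((eventually_mem_nhdsWithin).and
        (eventually_nhdsWithin_of_eventually_nhds (eventually_lt_nhds ha)))
  obtain ⟨b, hb, hb0, hba⟩ := hev.exists
  obtain ⟨σ, ⟨h1, h2⟩, h3⟩ := intermediate_value_Icc' hba.le
    ((continuousOn_binaryMI hq hq1).mono fun x hx => hb0.trans_le hx.1) ⟨h, hb.le⟩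
  exact ⟨σ, hb0.trans_le h1, h2, h3⟩

lemma exists_binaryMI_eq {q β : ℝ} (h : (q, β) ∈ calibrationRegion) :
    ∃ σ, 0 < σ ∧ binaryMI q σ = β := by
  obtain ⟨hq, hq1, hβ, hβ1⟩ := h
  obtain ⟨a, ha, ha0⟩ := (((tendsto_binaryMI_atTop hq hq1).eventually_lt_const hβ).and
    (eventually_gt_atTop 0)).exists
  obtain ⟨σ, h1, -, h2⟩ := exists_binaryMI_eq_of_le hq hq1 hβ1 ha0 ha.le
  exact ⟨σ, h1, h2⟩

lemma bddBelow_calibration (q β : ℝ) : BddBelow {σ : ℝ | 0 < σ ∧ binaryMI q σ = β} :=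
  ⟨0, fun _ h => h.1.le⟩

/-- The infimum is itself a solution: solutions stay away from `0`, where the limit `h(q)` exceeds
`β`, and by continuity the equation survives in the closure of the solution set. Uniqueness plays no
role. -/
lemma binaryMIInv_spec {q β : ℝ} (h : (q, β) ∈ calibrationRegion) :
    0 < binaryMIInv q β ∧ binaryMI q (binaryMIInv q β) = β := by
  have hne : {σ : ℝ | 0 < σ ∧ binaryMI q σ = β}.Nonempty := exists_binaryMI_eq h
  obtain ⟨hq, hq1, hβ, hβ1⟩ := h
  have hpos : 0 < binaryMIInv q β := by
    obtain ⟨ε, hε, hε'⟩ := (mem_nhdsGT_iff_exists_Ioo_subset).1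
      ((tendsto_binaryMI_zero hq hq1).eventually_const_lt hβ1)
    refine lt_of_lt_of_le hε (le_csInf hne fun σ hσ => ?_)
    by_contra hlt
    exact (hε' ⟨hσ.1, not_le.1 hlt⟩ : β < binaryMI q σ).ne' hσ.2
  refine ⟨hpos, ?_⟩
  have hcl := csInf_mem_closure hne (bddBelow_calibration q β)
  have hc : ContinuousAt (binaryMI q) (binaryMIInv q β) :=
    (continuousOn_binaryMI hq hq1).continuousAt (Ioi_mem_nhds hpos)
  have := hc.continuousWithinAt (s := {σ : ℝ | 0 < σ ∧ binaryMI q σ = β}) |>.mem_closure_image hcl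
  have himg : binaryMI q '' {σ : ℝ | 0 < σ ∧ binaryMI q σ = β} ⊆ {β} := by
    rintro _ ⟨σ, hσ, rfl⟩
    exact hσ.2
  simpa using closure_mono himg this

lemma measurable_binaryMI {σ : ℝ} (hσ : 0 < σ) : Measurable fun q => binaryMI q σ := by
  simp only [binaryMI_eq hσ]
  have h1 := measurable_gaussLogMix σ⁻¹
  have h2 := (measurable_gaussLogMix (-σ⁻¹)).comp (by fun_prop : Measurable fun q : ℝ => 1 - q)
  exact (measurable_id.mul h1).neg.sub ((measurable_const.sub measurable_id).mul h2)

/-- Turns an uncountable quantifier over `σ` into countable ones. The slack `1 / (k + 1)` makes the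
inequality open, hence testable at rationals; compactness recovers a point with no slack. -/
lemma exists_Icc_le_iff {f : ℝ → ℝ} {c b β : ℝ} (hcb : c < b) (hf : ContinuousOn f (Set.Icc c b)) :
    (∃ σ ∈ Set.Icc c b, f σ ≤ β) ↔
      ∀ k : ℕ, ∃ r : ℚ, (r : ℝ) ∈ Set.Ioo c b ∧ f r < β + 1 / ((k : ℝ) + 1) := by
  constructor
  · rintro ⟨σ, hσ, h⟩ k
    have hlt : f σ < β + 1 / ((k : ℝ) + 1) := by
      have : (0 : ℝ) < 1 / ((k : ℝ) + 1) := by positivity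
      linarith
    have hmem : σ ∈ closure (Set.Ioo c b) := by rwa [closure_Ioo hcb.ne]
    have hev : ∀ᶠ x in 𝓝[Set.Ioo c b] σ, f x < β + 1 / ((k : ℝ) + 1) :=
      ((hf σ hσ).mono Set.Ioo_subset_Icc_self).eventually_lt_const hlt
    obtain ⟨U, hU, hσU, hUs⟩ := mem_nhdsWithin.1 hev
    obtain ⟨x, hxU, hx⟩ := mem_closure_iff.1 hmem U hU hσU
    obtain ⟨r, hr⟩ := Rat.denseRange_cast.exists_mem_open (hU.inter isOpen_Ioo) ⟨x, hxU, hx⟩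
    exact ⟨r, hr.2, hUs hr⟩
  · intro h
    obtain ⟨σ, hσ, hmin⟩ := isCompact_Icc.exists_isMinOn (Set.nonempty_Icc.2 hcb.le) hf
    refine ⟨σ, hσ, ?_⟩
    have : Tendsto (fun k : ℕ => β + 1 / ((k : ℝ) + 1)) atTop (𝓝 (β + 0)) :=
      tendsto_one_div_add_atTop_nhds_zero_nat.const_add β
    rw [add_zero] at this
    refine ge_of_tendsto' this fun k => ?_
    obtain ⟨r, hr, hlt⟩ := h k
    exact (hmin (Set.Ioo_subset_Icc_self hr)).trans hlt.le

lemma measurableSet_calibrationRegion : MeasurableSet calibrationRegion := by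
  have := Real.binEntropy_continuous.measurable
  unfold calibrationRegion
  measurability

/-- The smallest solution is below `a` exactly when `binaryMI q` is at most `β` somewhere in `(0,
a)`; rational `c` and `b` confine that point to a compact interval. -/
lemma binaryMIInv_lt_iff {q β a : ℝ} (h : (q, β) ∈ calibrationRegion) :
    binaryMIInv q β < a ↔ ∃ c b : ℚ, (0 < (c : ℝ) ∧ (c : ℝ) < b ∧ (b : ℝ) < a) ∧
      ∀ k : ℕ, ∃ r : ℚ, (r : ℝ) ∈ Set.Ioo (c : ℝ) b ∧
        binaryMI q r < β + 1 / ((k : ℝ) + 1) := by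
  have key : ∀ c b : ℚ, 0 < (c : ℝ) → (c : ℝ) < b → ((∃ σ ∈ Set.Icc (c : ℝ) b, binaryMI q σ ≤ β) ↔
      ∀ k : ℕ, ∃ r : ℚ, (r : ℝ) ∈ Set.Ioo (c : ℝ) b ∧ binaryMI q r < β + 1 / ((k : ℝ) + 1)) :=
    fun c b hc hcb => exists_Icc_le_iff hcb
      ((continuousOn_binaryMI h.1 h.2.1).mono fun x hx => hc.trans_le hx.1)
  constructor
  · intro hlt
    obtain ⟨hpos, heq⟩ := binaryMIInv_spec h
    obtain ⟨c, hc0, hc⟩ := exists_rat_btwn hpos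
    obtain ⟨b, hb, hba⟩ := exists_rat_btwn hlt
    exact ⟨c, b, ⟨hc0, hc.trans hb, hba⟩,
      (key c b hc0 (hc.trans hb)).1 ⟨_, ⟨hc.le, hb.le⟩, heq.le⟩⟩
  · rintro ⟨c, b, ⟨hc, hcb, hba⟩, hk⟩
    obtain ⟨σ, hσ, hle⟩ := (key c b hc hcb).2 hk
    obtain ⟨τ, hτ, hτσ, hτe⟩ := exists_binaryMI_eq_of_le h.1 h.2.1 h.2.2.2 (hc.trans_le hσ.1) hle
    exact (csInf_le (bddBelow_calibration q β) ⟨hτ, hτe⟩).trans_lt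
      ((hτσ.trans hσ.2).trans_lt hba)

/-- The calibrated noise level, set to `0` outside the calibration region. -/
noncomputable def calibratedNoise (p : ℝ × ℝ) : ℝ :=
  calibrationRegion.indicator (fun p => binaryMIInv p.1 p.2) p

/-- Sublevel sets are built by countable operations from conditions at a fixed rational `r`, so
measurability in `q` at each fixed `σ` is enough. -/
lemma measurable_calibratedNoise : Measurable calibratedNoise := by
  have hS : ∀ a : ℝ, MeasurableSet {p : ℝ × ℝ | ∃ c b : ℚ, (0 < (c : ℝ) ∧ (c : ℝ) < b ∧ (b : ℝ) < a) ∧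
      ∀ k : ℕ, ∃ r : ℚ, (r : ℝ) ∈ Set.Ioo (c : ℝ) b ∧
        binaryMI p.1 r < p.2 + 1 / ((k : ℝ) + 1)} := by
    intro a
    have : {p : ℝ × ℝ | ∃ c b : ℚ, (0 < (c : ℝ) ∧ (c : ℝ) < b ∧ (b : ℝ) < a) ∧
      ∀ k : ℕ, ∃ r : ℚ, (r : ℝ) ∈ Set.Ioo (c : ℝ) b ∧
        binaryMI p.1 r < p.2 + 1 / ((k : ℝ) + 1)} = ⋃ c : ℚ, ⋃ b : ℚ,
        ⋃ _ : 0 < (c : ℝ) ∧ (c : ℝ) < b ∧ (b : ℝ) < a, ⋂ k : ℕ, ⋃ r : ℚ,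
        ⋃ _ : (r : ℝ) ∈ Set.Ioo (c : ℝ) b, {p : ℝ × ℝ | binaryMI p.1 r < p.2 + 1 / ((k : ℝ) + 1)} := by
      ext p
      simp only [Set.mem_ofPred_eq, Set.mem_iUnion, Set.mem_iInter, exists_prop]
    rw [this]
    refine .iUnion fun c => .iUnion fun b => .iUnion fun h => .iInter fun k => .iUnion fun r =>
      .iUnion fun hr => measurableSet_lt ?_ (by fun_prop)
    exact (measurable_binaryMI (h.1.trans hr.1)).comp measurable_fst
  refine measurable_of_Iio fun a => ?_
  have : calibratedNoise ⁻¹' Set.Iio a = (calibrationRegion ∩ {p : ℝ × ℝ | ∃ c b : ℚ,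
      (0 < (c : ℝ) ∧ (c : ℝ) < b ∧ (b : ℝ) < a) ∧
      ∀ k : ℕ, ∃ r : ℚ, (r : ℝ) ∈ Set.Ioo (c : ℝ) b ∧
        binaryMI p.1 r < p.2 + 1 / ((k : ℝ) + 1)}) ∪ (calibrationRegionᶜ ∩ {_p | 0 < a}) := by
    ext p
    by_cases hp : p ∈ calibrationRegion
    · simp only [Set.mem_preimage, calibratedNoise, Set.indicator_of_mem hp, Set.mem_Iio,
        Set.mem_union, Set.mem_inter_iff, hp, true_and, Set.mem_compl_iff, not_true, false_and,
        or_false, Set.mem_ofPred_eq]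
      exact binaryMIInv_lt_iff hp
    · simp [calibratedNoise, hp]
  rw [this]
  exact (measurableSet_calibrationRegion.inter (hS a)).union
    (measurableSet_calibrationRegion.compl.inter (MeasurableSet.const _))

/-! ### The posterior update -/

/-- The posterior after the observation `y = s_m + 𝒩(0, σ²)`, for the prior `p`. -/
noncomputable def bayes {M : ℕ} (p s : Fin M → ℝ) (σ y : ℝ) (m : Fin M) : ℝ :=
  p m * phi σ (y - s m) / ∑ k, p k * phi σ (y - s k)

/-- The Shannon entropy of a probability vector, in nats. -/
noncomputable def entropy {M : ℕ} (p : Fin M → ℝ) : ℝ := ∑ m, Real.negMulLog (p m)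

/-- Probability vectors with positive entries. -/
structure IsPosProb {M : ℕ} (p : Fin M → ℝ) : Prop where
  pos : ∀ m, 0 < p m
  sum_eq : ∑ m, p m = 1

lemma IsPosProb.le_one {M : ℕ} {p : Fin M → ℝ} (hp : IsPosProb p) (m : Fin M) : p m ≤ 1 := by
  rw [← hp.sum_eq]
  exact Finset.single_le_sum (fun k _ => (hp.pos k).le) (Finset.mem_univ m)

lemma IsPosProb.entropy_nonneg {M : ℕ} {p : Fin M → ℝ} (hp : IsPosProb p) : 0 ≤ entropy p :=
  Finset.sum_nonneg fun m _ => Real.negMulLog_nonneg (hp.pos m).le (hp.le_one m)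

section Bayes

variable {M : ℕ} {p s : Fin M → ℝ} {σ : ℝ}

lemma normalizer_pos [NeZero M] (hp : ∀ m, 0 < p m) (hσ : 0 < σ) (y : ℝ) :
    0 < ∑ k, p k * phi σ (y - s k) :=
  Finset.sum_pos (fun k _ => mul_pos (hp k) (phi_pos hσ _)) Finset.univ_nonempty

lemma IsPosProb.bayes [NeZero M] (hp : IsPosProb p) (hσ : 0 < σ) (y : ℝ) :
    IsPosProb (bayes p s σ y) where
  pos m := div_pos (mul_pos (hp.pos m) (phi_pos hσ _)) (normalizer_pos hp.pos hσ y)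
  sum_eq := by
    simp only [PACZero.bayes, ← Finset.sum_div]
    exact div_self (normalizer_pos hp.pos hσ y).ne'

lemma measurable_bayes (m : Fin M) : Measurable fun y => bayes p s σ y m := by
  have hm : Measurable fun y => phi σ y :=
    measurable_phi.comp (by fun_prop : Measurable fun y : ℝ => (σ, y))
  unfold bayes
  fun_prop

/-- Given the observation, the secret index is distributed according to the posterior. -/
lemma sum_lintegral_bayes [NeZero M] (hp : ∀ m, 0 < p m) (hσ : 0 < σ) {F : Fin M → ℝ → ℝ≥0∞}
    (hF : ∀ m, Measurable (F m)) :
    ∑ m, ENNReal.ofReal (p m) * ∫⁻ x, F m (s m + σ * x) ∂gaussianReal 0 1 =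
      ∑ k, ENNReal.ofReal (p k) * ∫⁻ x, ∑ m, ENNReal.ofReal (bayes p s σ (s k + σ * x) m) *
        F m (s k + σ * x) ∂gaussianReal 0 1 := by
  have hm : Measurable fun y => phi σ y :=
    measurable_phi.comp (by fun_prop : Measurable fun y : ℝ => (σ, y))
  have hb := measurable_bayes (p := p) (s := s) (σ := σ)
  have hG : Measurable fun y => ∑ m, ENNReal.ofReal (bayes p s σ y m) * F m y :=
    Finset.measurable_fun_sum _ fun m _ => (hb m).ennreal_ofReal.mul (hF m)
  have h1 : ∀ m, ENNReal.ofReal (p m) * ∫⁻ x, F m (s m + σ * x) ∂gaussianReal 0 1 =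
      ∫⁻ y, ENNReal.ofReal (p m * phi σ (y - s m)) * F m y := fun m => by
    rw [lintegral_gaussian_affine hσ (hF m), ← lintegral_const_mul _ (by fun_prop)]
    simp only [ENNReal.ofReal_mul (hp m).le, mul_assoc]
  have h2 : ∀ k, ENNReal.ofReal (p k) * ∫⁻ x, ∑ m, ENNReal.ofReal (bayes p s σ (s k + σ * x) m) *
        F m (s k + σ * x) ∂gaussianReal 0 1 =
      ∫⁻ y, ENNReal.ofReal (p k * phi σ (y - s k)) *
        ∑ m, ENNReal.ofReal (bayes p s σ y m) * F m y := fun k => by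
    rw [lintegral_gaussian_affine hσ hG, ← lintegral_const_mul _ (by fun_prop)]
    simp only [ENNReal.ofReal_mul (hp k).le, mul_assoc]
  simp only [h1, h2]
  -- With both sides as integrals over `y`, the weights `p k * phi σ (y - s k)` sum to the
  -- normalizer, which cancels the denominator of `bayes`.
  rw [← lintegral_finsetSum _ fun m _ => by fun_prop, ← lintegral_finsetSum _ fun m _ => by fun_prop]
  refine lintegral_congr fun y => ?_
  rw [← Finset.sum_mul, ← ENNReal.ofReal_sum_of_nonneg
    fun k _ => (mul_pos (hp k) (phi_pos hσ _)).le, Finset.mul_sum]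
  refine Finset.sum_congr rfl fun m _ => ?_
  rw [← mul_assoc, ← ENNReal.ofReal_mul (normalizer_pos hp hσ y).le, bayes,
    mul_div_cancel₀ _ (normalizer_pos hp hσ y).ne']

lemma one_sub_sum_indicator (hp : IsPosProb p) {q : ℝ}
    (hq : q = ∑ m, p m * (if s m = 1 then 1 else 0)) :
    1 - q = ∑ m, p m * (if s m = 1 then 0 else 1) := by
  have h : 1 - q = ∑ m, p m - ∑ m, p m * (if s m = 1 then 1 else 0) := by rw [hp.sum_eq, hq]
  rw [h, ← Finset.sum_sub_distrib]
  refine Finset.sum_congr rfl fun m _ => ?_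
  split_ifs <;> ring

lemma normalizer_eq_mixDensity (hp : IsPosProb p) (hs : ∀ m, s m = 1 ∨ s m = -1) {q : ℝ}
    (hq : q = ∑ m, p m * (if s m = 1 then 1 else 0)) (y : ℝ) :
    ∑ k, p k * phi σ (y - s k) = mixDensity q σ y := by
  have h1 := one_sub_sum_indicator hp hq
  rw [mixDensity, h1, hq, Finset.sum_mul, Finset.sum_mul, ← Finset.sum_add_distrib]
  refine Finset.sum_congr rfl fun m _ => ?_
  rcases hs m with h | h <;> norm_num [h]

/-- Entropy as the mean surprise under `p`. The shift `c` stays inside `ofReal` to avoid subtraction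
of extended reals. -/
lemma sum_mul_ofReal_neg_log {p : Fin M → ℝ} (hp : IsPosProb p) {c : ℝ} (hc : 0 ≤ c) :
    ∑ m, ENNReal.ofReal (p m) * ENNReal.ofReal (-Real.log (p m) + c) =
      ENNReal.ofReal (entropy p + c) := by
  simp only [← ENNReal.ofReal_mul (hp.pos _).le]
  rw [← ENNReal.ofReal_sum_of_nonneg]
  · congr 1
    simp only [mul_add, Finset.sum_add_distrib, ← Finset.sum_mul, hp.sum_eq, entropy,
      Real.negMulLog]
    simp
  · intro m _
    have := Real.log_nonpos (hp.pos m).le (hp.le_one m)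
    exact mul_nonneg (hp.pos m).le (by linarith)

/-- The expected decrease of the entropy of the posterior is the mutual information of the
channel. -/
lemma sum_lintegral_entropy_bayes [NeZero M] (hp : IsPosProb p) (hσ : 0 < σ)
    (hs : ∀ m, s m = 1 ∨ s m = -1) {q c : ℝ}
    (hq : q = ∑ m, p m * (if s m = 1 then 1 else 0)) (hq0 : 0 < q) (hq1 : q < 1)
    (hc : 0 ≤ c) (hmi : 0 ≤ binaryMI q σ) :
    ∑ k, ENNReal.ofReal (p k) * ∫⁻ x, ENNReal.ofReal
        (entropy (bayes p s σ (s k + σ * x)) + (c + binaryMI q σ)) ∂gaussianReal 0 1 =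
      ENNReal.ofReal (entropy p + c) := by
  have hc' : 0 ≤ c + binaryMI q σ := add_nonneg hc hmi
  -- Bayes' rule applied to the surprise: the mean posterior entropy becomes the mean of `-log` of
  -- the posterior at the true index, which is explicit.
  have hA := sum_lintegral_bayes (s := s) hp.pos hσ (F := fun m y =>
    ENNReal.ofReal (-Real.log (bayes p s σ y m) + (c + binaryMI q σ)))
    (fun m => by have := measurable_bayes (p := p) (s := s) (σ := σ) m; fun_prop)
  simp only [sum_mul_ofReal_neg_log (hp.bayes hσ _) hc'] at hA
  rw [← hA]
  set g : Fin M → ℝ := fun m =>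
    if s m = 1 then gaussLogMix q σ⁻¹ else gaussLogMix (1 - q) (-σ⁻¹) with hg
  -- At the true index the posterior is the prior times a likelihood ratio, and that ratio depends
  -- on the index only through its sign.
  have hlog : ∀ m x, -Real.log (bayes p s σ (s m + σ * x) m) = -Real.log (p m) +
      (if s m = 1 then Real.log (q + (1 - q) * Real.exp (-2 * (x * σ⁻¹ + σ⁻¹ ^ 2))) else
        Real.log ((1 - q) + (1 - (1 - q)) * Real.exp (-2 * (x * -σ⁻¹ + (-σ⁻¹) ^ 2)))) := by
    intro m x
    have hD : 0 < mixDensity q σ (s m + σ * x) := by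
      rw [← normalizer_eq_mixDensity hp hs hq]; exact normalizer_pos hp.pos hσ _
    rw [bayes, normalizer_eq_mixDensity hp hs hq, mul_div_assoc,
      Real.log_mul (hp.pos m).ne' (div_pos (phi_pos hσ _) hD).ne']
    rcases hs m with h | h
    · rw [h, log_phi_div_mixDensity_one hσ, if_pos rfl]; ring
    · rw [h, sub_neg_eq_add, log_phi_div_mixDensity_neg_one hσ, if_neg (by norm_num)]; ring
  have hint : ∀ m, Integrable (fun x => -Real.log (bayes p s σ (s m + σ * x) m))
      (gaussianReal 0 1) ∧
      ∫ x, -Real.log (bayes p s σ (s m + σ * x) m) ∂gaussianReal 0 1 = -Real.log (p m) + g m := by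
    intro m
    simp only [hlog, hg]
    split_ifs
    · have := integrable_log_mix hq0 hq1 σ⁻¹
      refine ⟨(integrable_const _).add this, ?_⟩
      rw [integral_add (integrable_const _) this]
      simp [gaussLogMix]
    · have := integrable_log_mix (a := 1 - q) (by linarith) (by linarith) (-σ⁻¹)
      refine ⟨(integrable_const _).add this, ?_⟩
      rw [integral_add (integrable_const _) this]
      simp [gaussLogMix]
  have hnn : ∀ m x, 0 ≤ -Real.log (bayes p s σ (s m + σ * x) m) + (c + binaryMI q σ) :=
    fun m x => by
      have hb := hp.bayes (s := s) hσ (s m + σ * x)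
      have := Real.log_nonpos (hb.pos m).le (hb.le_one m)
      linarith
  have hint' : ∀ m, Integrable (fun x => -Real.log (bayes p s σ (s m + σ * x) m) +
      (c + binaryMI q σ)) (gaussianReal 0 1) := fun m => (hint m).1.add (integrable_const _)
  have hval : ∀ m, ∫ x, (-Real.log (bayes p s σ (s m + σ * x) m) + (c + binaryMI q σ))
      ∂gaussianReal 0 1 = -Real.log (p m) + g m + (c + binaryMI q σ) := fun m => by
    rw [integral_add (hint m).1 (integrable_const _), (hint m).2]
    simp
  have hterm : ∀ m, ∫⁻ x, ENNReal.ofReal (-Real.log (bayes p s σ (s m + σ * x) m) +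
      (c + binaryMI q σ)) ∂gaussianReal 0 1 =
      ENNReal.ofReal (-Real.log (p m) + g m + (c + binaryMI q σ)) := by
    intro m
    rw [← ofReal_integral_eq_lintegral_ofReal (hint' m) (ae_of_all _ (hnn m)), hval]
  have htn : ∀ m, 0 ≤ -Real.log (p m) + g m + (c + binaryMI q σ) := by
    intro m
    rw [← hval]
    exact integral_nonneg (hnn m)
  simp only [hterm, ← ENNReal.ofReal_mul (hp.pos _).le]
  rw [← ENNReal.ofReal_sum_of_nonneg fun m _ => mul_nonneg (hp.pos m).le (htn m)]
  congr 1
  -- Grouping the indices by sign gives weights `q` and `1 - q`, hence minus the channel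
  -- information.
  have hgs : ∑ m, p m * g m = -binaryMI q σ := by
    have h1 := one_sub_sum_indicator hp hq
    have h2 : ∑ m, p m * g m = q * gaussLogMix q σ⁻¹ + (1 - q) * gaussLogMix (1 - q) (-σ⁻¹) := by
      conv_rhs => rw [h1]
      conv_rhs => enter [1, 1]; rw [hq]
      rw [Finset.sum_mul, Finset.sum_mul, ← Finset.sum_add_distrib]
      refine Finset.sum_congr rfl fun m _ => ?_
      simp only [hg, ← h1]
      split_ifs <;> ring
    rw [h2, binaryMI_eq hσ]; ring
  simp only [mul_add, Finset.sum_add_distrib, ← Finset.sum_mul, hp.sum_eq, hgs, entropy,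
    Real.negMulLog]
  simp only [neg_mul, mul_neg]
  ring

end Bayes

/-! ### Measurability of the algorithm -/

instance (d M : ℕ) : MeasurableSpace (State d M) :=
  MeasurableSpace.comap (fun st => (st.theta, st.post, st.used)) inferInstance

lemma measurable_stateData (d M : ℕ) :
    Measurable fun st : State d M => (st.theta, st.post, st.used) := comap_measurable _

lemma measurable_theta {d M : ℕ} : Measurable fun st : State d M => st.theta :=
  (measurable_stateData d M).fst

lemma measurable_post {d M : ℕ} : Measurable fun st : State d M => st.post :=
  (measurable_stateData d M).snd.fst

lemma measurable_used {d M : ℕ} : Measurable fun st : State d M => st.used :=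
  (measurable_stateData d M).snd.snd

lemma measurable_state_mk {α : Type*} [MeasurableSpace α] {d M : ℕ}
    {θ : α → EuclideanSpace ℝ (Fin d)} {p : α → Fin M → ℝ} {u : α → ℝ}
    (hθ : Measurable θ) (hp : Measurable p) (hu : Measurable u) :
    Measurable fun a => (⟨θ a, p a, u a⟩ : State d M) :=
  measurable_comap_iff.2 (hθ.prodMk (hp.prodMk hu))

lemma measurable_entropy {M : ℕ} : Measurable (entropy : (Fin M → ℝ) → ℝ) := by
  have := Real.continuous_negMulLog.measurable
  unfold entropy
  fun_prop

lemma measurable_sgn : Measurable sgn :=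
  Measurable.ite (measurableSet_le measurable_const measurable_id) measurable_const
    measurable_const

lemma sgn_eq_or (x : ℝ) : sgn x = 1 ∨ sgn x = -1 := by
  unfold sgn; split_ifs <;> simp

lemma measurable_realSign : Measurable Real.sign := by
  have : Real.sign = fun r : ℝ => if r < 0 then (-1 : ℝ) else if 0 < r then 1 else 0 := rfl
  rw [this]
  exact Measurable.ite measurableSet_Iio measurable_const
    (Measurable.ite measurableSet_Ioi measurable_const measurable_const)

namespace Config

variable {d N M : ℕ} (C : Config d N M)

lemma subsetSign_eq_or (θ z : EuclideanSpace ℝ (Fin d)) (m : Fin M) :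
    C.subsetSign θ z m = 1 ∨ C.subsetSign θ z m = -1 := sgn_eq_or _

lemma measurable_subsetSign (hloss : ∀ i, Measurable (C.loss i)) (m : Fin M) :
    Measurable fun p : EuclideanSpace ℝ (Fin d) × EuclideanSpace ℝ (Fin d) =>
      C.subsetSign p.1 p.2 m := by
  have hz : ∀ i, Measurable fun p : EuclideanSpace ℝ (Fin d) × EuclideanSpace ℝ (Fin d) =>
      C.zoScalar p.1 p.2 i := fun i => by
    have h1 : Measurable fun p : EuclideanSpace ℝ (Fin d) × EuclideanSpace ℝ (Fin d) =>
        (C.loss i (p.1 + C.mu • p.2) - C.loss i (p.1 - C.mu • p.2)) / (2 * C.mu) := by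
      have := hloss i
      fun_prop
    exact (measurable_realSign.comp h1).mul (h1.abs.min measurable_const)
  exact measurable_sgn.comp
    (measurable_const.mul (Finset.measurable_fun_sum _ fun i _ => hz i))

lemma measurable_subsetSign_state (hloss : ∀ i, Measurable (C.loss i)) (m : Fin M) :
    Measurable fun p : State d M × EuclideanSpace ℝ (Fin d) => C.subsetSign p.1.theta p.2 m := by
  have hz : Measurable fun p : State d M × EuclideanSpace ℝ (Fin d) => (p.1.theta, p.2) :=
    (measurable_theta.comp measurable_fst).prodMk measurable_snd
  have h := (C.measurable_subsetSign hloss m).comp hz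
  exact h

lemma measurable_agreeProb (hloss : ∀ i, Measurable (C.loss i)) :
    Measurable fun p : State d M × EuclideanSpace ℝ (Fin d) => C.agreeProb p.1 p.2 := by
  unfold agreeProb
  refine Finset.measurable_fun_sum _ fun m _ => ?_
  have h1 : Measurable fun p : State d M × EuclideanSpace ℝ (Fin d) => p.1.post m :=
    (measurable_pi_apply m).comp (measurable_post.comp measurable_fst)
  exact h1.mul (Measurable.ite
    ((C.measurable_subsetSign_state hloss m) (measurableSet_singleton 1))
    measurable_const measurable_const)

lemma measurable_stepBudget (hloss : ∀ i, Measurable (C.loss i)) (t : ℕ) :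
    Measurable fun p : State d M × EuclideanSpace ℝ (Fin d) => C.stepBudget t p.1 p.2 := by
  have h1 := C.measurable_agreeProb hloss
  have h2 := Real.binEntropy_continuous.measurable
  have h3 : Measurable fun p : State d M × EuclideanSpace ℝ (Fin d) => p.1.used :=
    measurable_used.comp measurable_fst
  unfold stepBudget
  exact ((measurable_const.max (measurable_const.sub h3)).div_const _).min
    (measurable_const.mul (h2.comp h1))

lemma measurableSet_unanimous (hloss : ∀ i, Measurable (C.loss i)) :
    MeasurableSet {p : State d M × EuclideanSpace ℝ (Fin d) | C.Unanimous p.1 p.2} :=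
  ((C.measurable_agreeProb hloss) (measurableSet_singleton 0)).union
    ((C.measurable_agreeProb hloss) (measurableSet_singleton 1))

open Classical in
/-- A measurable version of the noise level. -/
noncomputable def calNoise (t : ℕ) (st : State d M) (z : EuclideanSpace ℝ (Fin d)) : ℝ :=
  if C.Unanimous st z then 0 else calibratedNoise (C.agreeProb st z, C.stepBudget t st z)

lemma measurable_calNoise (hloss : ∀ i, Measurable (C.loss i)) (t : ℕ) :
    Measurable fun p : State d M × EuclideanSpace ℝ (Fin d) => C.calNoise t p.1 p.2 :=
  Measurable.ite (C.measurableSet_unanimous hloss) measurable_const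
    (measurable_calibratedNoise.comp
      ((C.measurable_agreeProb hloss).prodMk (C.measurable_stepBudget hloss t)))

open Classical in
/-- The state and the record of the released bits after the observation `y` in the step `t`. -/
noncomputable def observe (t : Fin C.rounds) (z : EuclideanSpace ℝ (Fin d)) (y : ℝ)
    (w : State d M × (Fin C.rounds → ℝ)) : State d M × (Fin C.rounds → ℝ) :=
  (⟨(1 - C.eta t * C.lam) • w.1.theta - (C.eta t * sgn y) • z,
    if C.Unanimous w.1 z then w.1.post else
      bayes w.1.post (C.subsetSign w.1.theta z) (C.calNoise t w.1 z) y,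
    w.1.used + if C.Unanimous w.1 z then 0 else C.stepBudget t w.1 z⟩,
    Function.update w.2 t (sgn y))

lemma measurable_observe (hloss : ∀ i, Measurable (C.loss i)) (t : Fin C.rounds) :
    Measurable fun p : EuclideanSpace ℝ (Fin d) × ℝ × (State d M × (Fin C.rounds → ℝ)) =>
      C.observe t p.1 p.2.1 p.2.2 := by
  have hsz : Measurable fun p : EuclideanSpace ℝ (Fin d) × ℝ × (State d M × (Fin C.rounds → ℝ)) =>
      (p.2.2.1, p.1) := by fun_prop
  have hy : Measurable fun p : EuclideanSpace ℝ (Fin d) × ℝ × (State d M × (Fin C.rounds → ℝ)) =>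
      p.2.1 := by fun_prop
  have hst : Measurable fun p : EuclideanSpace ℝ (Fin d) × ℝ ×
      (State d M × (Fin C.rounds → ℝ)) => p.2.2.1 := by fun_prop
  have hsg : Measurable fun p : EuclideanSpace ℝ (Fin d) × ℝ ×
      (State d M × (Fin C.rounds → ℝ)) => sgn p.2.1 := measurable_sgn.comp hy
  have hθ : Measurable fun p : EuclideanSpace ℝ (Fin d) × ℝ ×
      (State d M × (Fin C.rounds → ℝ)) => p.2.2.1.theta :=
    measurable_theta.comp hst
  have hp : ∀ m, Measurable fun p : EuclideanSpace ℝ (Fin d) × ℝ ×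
      (State d M × (Fin C.rounds → ℝ)) => p.2.2.1.post m :=
    fun m => (measurable_pi_apply m).comp (measurable_post.comp hst)
  have hu : Measurable fun p : EuclideanSpace ℝ (Fin d) × ℝ ×
      (State d M × (Fin C.rounds → ℝ)) => p.2.2.1.used :=
    measurable_used.comp hst
  have hσ : Measurable fun p : EuclideanSpace ℝ (Fin d) × ℝ ×
      (State d M × (Fin C.rounds → ℝ)) => C.calNoise t p.2.2.1 p.1 := by
    have h := (C.measurable_calNoise hloss t).comp hsz
    exact h
  have hb : Measurable fun p : EuclideanSpace ℝ (Fin d) × ℝ ×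
      (State d M × (Fin C.rounds → ℝ)) => C.stepBudget t p.2.2.1 p.1 := by
    have h := (C.measurable_stepBudget hloss t).comp hsz
    exact h
  have hun : MeasurableSet {p : EuclideanSpace ℝ (Fin d) × ℝ ×
      (State d M × (Fin C.rounds → ℝ)) |
      C.Unanimous p.2.2.1 p.1} := hsz (C.measurableSet_unanimous hloss)
  have hs : ∀ m, Measurable fun p : EuclideanSpace ℝ (Fin d) × ℝ ×
      (State d M × (Fin C.rounds → ℝ)) =>
      C.subsetSign p.2.2.1.theta p.1 m := fun m => by
    have h := (C.measurable_subsetSign_state hloss m).comp hsz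
    exact h
  have hphi : ∀ m, Measurable fun p : EuclideanSpace ℝ (Fin d) × ℝ ×
      (State d M × (Fin C.rounds → ℝ)) =>
      p.2.2.1.post m * phi (C.calNoise t p.2.2.1 p.1)
        (p.2.1 - C.subsetSign p.2.2.1.theta p.1 m) := fun m => by
    have h := (hp m).mul (measurable_phi.comp (hσ.prodMk (hy.sub (hs m))))
    exact h
  refine Measurable.prodMk (measurable_state_mk ?_ ?_ ?_) ?_
  · exact (hθ.const_smul (1 - C.eta t * C.lam)).sub ((measurable_const.mul hsg).smul measurable_fst)
  · refine Measurable.ite hun (measurable_pi_lambda _ hp) (measurable_pi_lambda _ fun m => ?_)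
    exact (hphi m).div (Finset.measurable_fun_sum _ fun k _ => hphi k)
  · exact hu.add (Measurable.ite hun measurable_const hb)
  · refine measurable_pi_lambda _ fun i => ?_
    by_cases h : i = t
    · subst h; simpa using hsg
    · simp only [Function.update_of_ne h]
      fun_prop

/-- The pre-quantized release with the measurable version of the noise level. -/
noncomputable def output (j : Fin M) (t : Fin C.rounds) (z : EuclideanSpace ℝ (Fin d)) (x : ℝ)
    (w : State d M × (Fin C.rounds → ℝ)) : ℝ :=
  C.subsetSign w.1.theta z j + C.calNoise t w.1 z * x

/-- One step of the algorithm, with the record of the released bits. -/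
noncomputable def advance (j : Fin M) (t : Fin C.rounds) (z : EuclideanSpace ℝ (Fin d)) (x : ℝ)
    (w : State d M × (Fin C.rounds → ℝ)) : State d M × (Fin C.rounds → ℝ) :=
  C.observe t z (C.output j t z x w) w

lemma measurable_advance (hloss : ∀ i, Measurable (C.loss i)) (j : Fin M) (t : Fin C.rounds) :
    Measurable fun p : EuclideanSpace ℝ (Fin d) × ℝ × (State d M × (Fin C.rounds → ℝ)) =>
      C.advance j t p.1 p.2.1 p.2.2 := by
  have hsz : Measurable fun p : EuclideanSpace ℝ (Fin d) × ℝ × (State d M × (Fin C.rounds → ℝ)) =>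
      (p.2.2.1, p.1) := by fun_prop
  have hy : Measurable fun p : EuclideanSpace ℝ (Fin d) × ℝ × (State d M × (Fin C.rounds → ℝ)) =>
      C.output j t p.1 p.2.1 p.2.2 := by
    have h1 := (C.measurable_subsetSign_state hloss j).comp hsz
    have h2 := (C.measurable_calNoise hloss t).comp hsz
    have h := h1.add (h2.mul measurable_snd.fst)
    exact h
  have h := (C.measurable_observe hloss t).comp
    (measurable_fst.prodMk (hy.prodMk measurable_snd.snd))
  exact h

/-- The state and the released bits (padded with zeros) after `t` steps. -/
noncomputable def history (j : Fin M) (z : Fin C.rounds → EuclideanSpace ℝ (Fin d))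
    (g : Fin C.rounds → ℝ) : (t : ℕ) → t ≤ C.rounds → State d M × (Fin C.rounds → ℝ)
  | 0, _ => (⟨C.theta0, fun _ => 1 / (M : ℝ), 0⟩, 0)
  | t + 1, h => C.advance j ⟨t, h⟩ (z ⟨t, h⟩) (g ⟨t, h⟩) (history j z g t (Nat.le_of_succ_le h))

lemma measurable_history (hloss : ∀ i, Measurable (C.loss i)) (j : Fin M) (t : ℕ)
    (ht : t ≤ C.rounds) :
    Measurable fun p : (Fin C.rounds → EuclideanSpace ℝ (Fin d)) × (Fin C.rounds → ℝ) =>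
      C.history j p.1 p.2 t ht := by
  induction t with
  | zero => exact measurable_const
  | succ t ih =>
    have hz : Measurable fun p : (Fin C.rounds → EuclideanSpace ℝ (Fin d)) ×
        (Fin C.rounds → ℝ) => p.1 ⟨t, ht⟩ := by fun_prop
    have hg : Measurable fun p : (Fin C.rounds → EuclideanSpace ℝ (Fin d)) ×
        (Fin C.rounds → ℝ) => p.2 ⟨t, ht⟩ := by fun_prop
    have h := (C.measurable_advance hloss j ⟨t, ht⟩).comp
      (hz.prodMk (hg.prodMk (ih (Nat.le_of_succ_le ht))))
    exact h

/-- Causality: noise from step `t` on does not affect the first `t` steps, so it can be integrated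
out separately. -/
lemma history_congr (j : Fin M) (z : Fin C.rounds → EuclideanSpace ℝ (Fin d))
    {g g' : Fin C.rounds → ℝ} (t : ℕ) (ht : t ≤ C.rounds)
    (h : ∀ i : Fin C.rounds, (i : ℕ) < t → g i = g' i) :
    C.history j z g t ht = C.history j z g' t ht := by
  induction t with
  | zero => rfl
  | succ t ih =>
    simp only [history]
    rw [ih (Nat.le_of_succ_le ht) fun i hi => h i (hi.trans (Nat.lt_succ_self t)),
      h ⟨t, ht⟩ (Nat.lt_succ_self t)]

/-! ### The invariants of a run -/

/-- The states that a run can reach before the step `t`. -/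
structure Valid (t : ℕ) (st : State d M) : Prop where
  post : IsPosProb st.post
  used_nonneg : 0 ≤ st.used
  used_le : st.used ≤ C.budget
  -- Strict, so that the next share of the budget is positive and can be calibrated. Equality is
  -- possible only after the last step, whose divisor is `1`.
  used_lt : t < C.rounds → st.used < C.budget

variable {C}

lemma Valid.agreeProb_mem {t : ℕ} {st : State d M} (h : C.Valid t st)
    {z : EuclideanSpace ℝ (Fin d)} (hu : ¬ C.Unanimous st z) :
    0 < C.agreeProb st z ∧ C.agreeProb st z < 1 := by
  have h0 : 0 ≤ C.agreeProb st z := Finset.sum_nonneg fun m _ => by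
    have := (h.post.pos m).le
    split_ifs <;> simp [this]
  have h1 : C.agreeProb st z ≤ 1 := by
    rw [← h.post.sum_eq]
    refine Finset.sum_le_sum fun m _ => ?_
    have := (h.post.pos m).le
    split_ifs <;> simp [this]
  rw [Unanimous, not_or] at hu
  exact ⟨lt_of_le_of_ne h0 (Ne.symm hu.1), lt_of_le_of_ne h1 hu.2⟩

/-- The unspent budget makes the share positive, and the factor `0.999` keeps it strictly below
`h(q)`, the information of the noiseless channel. -/
lemma Valid.mem_calibrationRegion {t : ℕ} {st : State d M} (h : C.Valid t st)
    (ht : t < C.rounds) {z : EuclideanSpace ℝ (Fin d)} (hu : ¬ C.Unanimous st z) :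
    (C.agreeProb st z, C.stepBudget t st z) ∈ calibrationRegion := by
  obtain ⟨h0, h1⟩ := h.agreeProb_mem hu
  have hH := Real.binEntropy_pos h0 h1
  have hT : (0 : ℝ) < (C.rounds : ℝ) - t := sub_pos.2 (by exact_mod_cast ht)
  refine ⟨h0, h1, lt_min (div_pos (lt_max_of_lt_right (sub_pos.2 (h.used_lt ht))) hT)
    (by positivity), (min_le_right _ _).trans_lt ?_⟩
  change 0.999 * Real.binEntropy (C.agreeProb st z) < Real.binEntropy (C.agreeProb st z)
  linarith

lemma Valid.calNoise_eq {t : ℕ} {st : State d M} (h : C.Valid t st) (ht : t < C.rounds)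
    (z : EuclideanSpace ℝ (Fin d)) : C.calNoise t st z = C.noiseLevel t st z := by
  unfold calNoise noiseLevel
  split_ifs with hu
  · rfl
  · rw [calibratedNoise, Set.indicator_of_mem (h.mem_calibrationRegion ht hu)]

lemma Valid.calNoise_spec {t : ℕ} {st : State d M} (h : C.Valid t st) (ht : t < C.rounds)
    {z : EuclideanSpace ℝ (Fin d)} (hu : ¬ C.Unanimous st z) :
    0 < C.calNoise t st z ∧
      binaryMI (C.agreeProb st z) (C.calNoise t st z) = C.stepBudget t st z := by
  rw [h.calNoise_eq ht, noiseLevel, if_neg hu]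
  exact binaryMIInv_spec (h.mem_calibrationRegion ht hu)

lemma Valid.observe [NeZero M] {t : Fin C.rounds} {w : State d M × (Fin C.rounds → ℝ)}
    (h : C.Valid t w.1) (z : EuclideanSpace ℝ (Fin d)) (y : ℝ) :
    C.Valid (t + 1) (C.observe t z y w).1 := by
  by_cases hu : C.Unanimous w.1 z
  · refine ⟨?_, ?_, ?_, ?_⟩ <;> simp only [Config.observe, if_pos hu, add_zero]
    exacts [h.post, h.used_nonneg, h.used_le, fun _ => h.used_lt t.2]
  · have hr := h.mem_calibrationRegion t.2 hu
    have hT : (1 : ℝ) ≤ (C.rounds : ℝ) - (t : ℕ) := by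
      have : ((t : ℕ) : ℝ) + 1 ≤ C.rounds := by exact_mod_cast t.2
      linarith
    have hpos : 0 < C.budget - w.1.used := sub_pos.2 (h.used_lt t.2)
    have hb : C.stepBudget t w.1 z ≤ (C.budget - w.1.used) / ((C.rounds : ℝ) - (t : ℕ)) := by
      rw [← max_eq_right hpos.le]; exact min_le_left _ _
    refine ⟨?_, ?_, ?_, ?_⟩ <;> simp only [Config.observe, if_neg hu]
    · exact h.post.bayes (h.calNoise_spec t.2 hu).1 y
    · exact add_nonneg h.used_nonneg hr.2.2.1.le
    · have := hb.trans (div_le_self hpos.le hT)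
      linarith
    · intro ht
      -- Another step follows, so the divisor exceeds `1` and the share is strictly less than what
      -- remains.
      have hT' : (1 : ℝ) < (C.rounds : ℝ) - (t : ℕ) := by
        have : ((t : ℕ) : ℝ) + 1 < C.rounds := by exact_mod_cast ht
        linarith
      have := hb.trans_lt (div_lt_self hpos hT')
      linarith

lemma valid_history [NeZero M] (hbudget : 0 < C.budget) (j : Fin M)
    (z : Fin C.rounds → EuclideanSpace ℝ (Fin d)) (g : Fin C.rounds → ℝ) (t : ℕ)
    (ht : t ≤ C.rounds) : C.Valid t (C.history j z g t ht).1 := by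
  induction t with
  | zero =>
    have hM : (0 : ℝ) < M := by exact_mod_cast Nat.pos_of_ne_zero (NeZero.ne M)
    refine ⟨⟨fun m => by simp only [history]; positivity, ?_⟩, le_rfl, hbudget.le,
      fun _ => hbudget⟩
    simp [history, hM.ne']
  | succ t ih => exact Valid.observe (t := ⟨t, ht⟩) (ih (Nat.le_of_succ_le ht)) _ _

/-- Reached states are valid, and there the measurable noise level agrees with the one of the
algorithm; the two runs therefore coincide pointwise. -/
lemma history_fst [NeZero M] (hbudget : 0 < C.budget) (j : Fin M)
    (z : Fin C.rounds → EuclideanSpace ℝ (Fin d)) (g : Fin C.rounds → ℝ) (t : ℕ)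
    (ht : t ≤ C.rounds) : (C.history j z g t ht).1 = C.state j z g t ht := by
  induction t with
  | zero => rfl
  | succ t ih =>
    have hv := valid_history hbudget j z g t (Nat.le_of_succ_le ht)
    have hn := hv.calNoise_eq ht (z ⟨t, ht⟩)
    rw [ih (Nat.le_of_succ_le ht)] at hn
    simp only [history, state, advance, observe, output, step, bit, release, nextPost]
    rw [ih (Nat.le_of_succ_le ht), hn]
    rfl

lemma history_snd [NeZero M] (hbudget : 0 < C.budget) (j : Fin M)
    (z : Fin C.rounds → EuclideanSpace ℝ (Fin d)) (g : Fin C.rounds → ℝ) (t : ℕ)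
    (ht : t ≤ C.rounds) (i : Fin C.rounds) (hi : (i : ℕ) < t) :
    (C.history j z g t ht).2 i = C.bits j z g i := by
  induction t with
  | zero => exact absurd hi (Nat.not_lt_zero _)
  | succ t ih =>
    have ht' := Nat.le_of_succ_le ht
    by_cases h : (i : ℕ) = t
    · have hv := valid_history hbudget j z g t ht'
      have hn := hv.calNoise_eq ht (z ⟨t, ht⟩)
      obtain rfl : i = ⟨t, ht⟩ := Fin.ext h
      rw [history_fst hbudget] at hn
      simp only [history, advance, observe, output, Function.update_self, bits, bit, release,
        history_fst hbudget, hn]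
    · have : i ≠ ⟨t, ht⟩ := fun h' => h (congrArg Fin.val h')
      simp only [history, advance, observe, Function.update_of_ne this]
      exact ih ht' (by omega)

lemma history_snd_rounds [NeZero M] (hbudget : 0 < C.budget) (j : Fin M)
    (z : Fin C.rounds → EuclideanSpace ℝ (Fin d)) (g : Fin C.rounds → ℝ) :
    (C.history j z g C.rounds le_rfl).2 = C.bits j z g :=
  funext fun i => history_snd hbudget j z g _ _ i i.2

/-! ### The posterior and its entropy along one step -/

/-- Every candidate keeps positive posterior mass, so `q ∈ {0, 1}` leaves no room for a dissenting
sign. A unanimous release is thus independent of the secret. -/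
lemma Valid.unanimous_subsetSign {t : ℕ} {st : State d M} (h : C.Valid t st)
    {z : EuclideanSpace ℝ (Fin d)} (hu : C.Unanimous st z) (j k : Fin M) :
    C.subsetSign st.theta z j = C.subsetSign st.theta z k := by
  rcases hu with h0 | h1
  · have hall : ∀ m, C.subsetSign st.theta z m = -1 := fun m => by
      rw [agreeProb, Finset.sum_eq_zero_iff_of_nonneg fun m _ => by
        have := (h.post.pos m).le
        split_ifs <;> simp [this]] at h0
      have := h0 m (Finset.mem_univ m)
      refine (C.subsetSign_eq_or _ _ m).resolve_left fun h' => ?_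
      rw [if_pos h', mul_one] at this
      exact (h.post.pos m).ne' this
    rw [hall, hall]
  · have hall : ∀ m, C.subsetSign st.theta z m = 1 := fun m => by
      have h2 : ∑ m, st.post m - C.agreeProb st z = 0 := by rw [h1, h.post.sum_eq, sub_self]
      rw [agreeProb, ← Finset.sum_sub_distrib, Finset.sum_eq_zero_iff_of_nonneg fun m _ => by
        have := (h.post.pos m).le
        split_ifs <;> simp [this]] at h2
      have := h2 m (Finset.mem_univ m)
      by_contra h'
      rw [if_neg h', mul_zero, sub_zero] at this
      exact (h.post.pos m).ne' this
    rw [hall, hall]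

/-- Bayes' rule for one step with the current posterior as prior. Under unanimity the new state
depends neither on the index nor on the noise, and the posterior is unchanged. -/
lemma Valid.sum_lintegral_advance [NeZero M] (hloss : ∀ i, Measurable (C.loss i))
    {t : Fin C.rounds}
    {w : State d M × (Fin C.rounds → ℝ)} (h : C.Valid t w.1) (z : EuclideanSpace ℝ (Fin d))
    {F : Fin M → State d M × (Fin C.rounds → ℝ) → ℝ≥0∞} (hF : ∀ m, Measurable (F m)) :
    ∑ m, ENNReal.ofReal (w.1.post m) * ∫⁻ x, F m (C.advance m t z x w) ∂gaussianReal 0 1 =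
      ∑ k, ENNReal.ofReal (w.1.post k) * ∫⁻ x, ∑ m,
        ENNReal.ofReal ((C.advance k t z x w).1.post m) * F m (C.advance k t z x w)
          ∂gaussianReal 0 1 := by
  by_cases hu : C.Unanimous w.1 z
  · have h0 : C.calNoise t w.1 z = 0 := if_pos hu
    have hadv : ∀ m x, C.advance m t z x w = C.advance 0 t z 0 w := fun m x => by
      simp only [advance, output, h0, zero_mul, h.unanimous_subsetSign hu m 0]
    have hpost : (C.advance 0 t z 0 w).1.post = w.1.post := by
      simp only [advance, Config.observe, if_pos hu]
    have hsum : ∑ k, ENNReal.ofReal (w.1.post k) = 1 := by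
      rw [← ENNReal.ofReal_sum_of_nonneg fun k _ => (h.post.pos k).le, h.post.sum_eq,
        ENNReal.ofReal_one]
    simp only [hadv, hpost, lintegral_const, measure_univ, mul_one]
    rw [← Finset.sum_mul, hsum, one_mul]
  · have hσ := (h.calNoise_spec t.2 hu).1
    have hm : Measurable fun y => C.observe t z y w :=
      (C.measurable_observe hloss t).comp
        (measurable_const.prodMk (measurable_id.prodMk measurable_const))
    have hpost : ∀ y, (C.observe t z y w).1.post =
        bayes w.1.post (C.subsetSign w.1.theta z) (C.calNoise t w.1 z) y := fun y => by
      simp only [Config.observe, if_neg hu]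
    simp only [advance, output, hpost]
    exact sum_lintegral_bayes h.post.pos hσ (F := fun m y => F m (C.observe t z y w))
      fun m => (hF m).comp hm

/-- The mean entropy loss `binaryMI` equals, by calibration, the amount added to `used`; under
unanimity both terms stay put. -/
lemma Valid.sum_lintegral_entropy_advance [NeZero M] {t : Fin C.rounds}
    {w : State d M × (Fin C.rounds → ℝ)} (h : C.Valid t w.1) (z : EuclideanSpace ℝ (Fin d)) :
    ∑ k, ENNReal.ofReal (w.1.post k) * ∫⁻ x, ENNReal.ofReal
        (entropy (C.advance k t z x w).1.post + (C.advance k t z x w).1.used) ∂gaussianReal 0 1 =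
      ENNReal.ofReal (entropy w.1.post + w.1.used) := by
  by_cases hu : C.Unanimous w.1 z
  · have hsum : ∑ k, ENNReal.ofReal (w.1.post k) = 1 := by
      rw [← ENNReal.ofReal_sum_of_nonneg fun k _ => (h.post.pos k).le, h.post.sum_eq,
        ENNReal.ofReal_one]
    simp only [advance, Config.observe, if_pos hu, add_zero, lintegral_const, measure_univ, mul_one]
    rw [← Finset.sum_mul, hsum, one_mul]
  · obtain ⟨hσ, hmi⟩ := h.calNoise_spec t.2 hu
    obtain ⟨hq0, hq1⟩ := h.agreeProb_mem hu
    have hr := h.mem_calibrationRegion t.2 hu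
    have := sum_lintegral_entropy_bayes h.post hσ (C.subsetSign_eq_or w.1.theta z)
      (q := C.agreeProb w.1 z) (c := w.1.used)
      (Finset.sum_congr rfl fun m _ => by congr) hq0 hq1 h.used_nonneg
      (hmi ▸ hr.2.2.1.le)
    simp only [advance, Config.observe, output, if_neg hu]
    rw [← this, hmi]

end Config

/-! ### Averaging over the noise of a whole run, for fixed directions. -/

/-- Resampling one coordinate leaves a product of probability measures invariant. -/
lemma lintegral_pi_update {ι : Type*} [Fintype ι] [DecidableEq ι] {X : ι → Type*}
    [∀ i, MeasurableSpace (X i)] (μ : ∀ i, Measure (X i)) [∀ i, IsProbabilityMeasure (μ i)]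
    (i : ι) {f : (∀ i, X i) → ℝ≥0∞} (hf : Measurable f) :
    ∫⁻ g, f g ∂Measure.pi μ = ∫⁻ g, ∫⁻ x, f (Function.update g i x) ∂μ i ∂Measure.pi μ := by
  have hm : Measurable fun g => ∫⁻ x, f (Function.update g i x) ∂μ i := by
    have := hf.lmarginal μ (s := {i})
    rwa [lmarginal_singleton] at this
  refine lintegral_eq_of_lmarginal_eq {i} hf hm ?_
  rw [lmarginal_singleton, lmarginal_singleton]
  funext g
  simp

namespace Config

variable {d N M : ℕ} {C : Config d N M}

lemma measurable_history_right (hloss : ∀ i, Measurable (C.loss i)) (j : Fin M)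
    (z : Fin C.rounds → EuclideanSpace ℝ (Fin d)) (t : ℕ) (ht : t ≤ C.rounds) :
    Measurable fun g => C.history j z g t ht := by
  have h := (C.measurable_history hloss j t ht).comp
    (measurable_const (a := z).prodMk measurable_id)
  exact h

/-- The noise of step `t` is independent of the history before it: resampling that coordinate
changes only the last step. -/
lemma lintegral_history_succ (hloss : ∀ i, Measurable (C.loss i)) (j : Fin M)
    (z : Fin C.rounds → EuclideanSpace ℝ (Fin d)) (t : ℕ) (ht : t + 1 ≤ C.rounds)
    {F : State d M × (Fin C.rounds → ℝ) → ℝ≥0∞} (hF : Measurable F) :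
    ∫⁻ g, F (C.history j z g (t + 1) ht) ∂Measure.pi (fun _ => gaussianReal 0 1) =
      ∫⁻ g, ∫⁻ x, F (C.advance j ⟨t, ht⟩ (z ⟨t, ht⟩) x
        (C.history j z g t (Nat.le_of_succ_le ht))) ∂gaussianReal 0 1
          ∂Measure.pi (fun _ => gaussianReal 0 1) := by
  have hm := measurable_history_right hloss j z (t + 1) ht
  rw [lintegral_pi_update _ ⟨t, ht⟩ (f := fun g => F (C.history j z g (t + 1) ht)) (hF.comp hm)]
  refine lintegral_congr fun g => lintegral_congr fun x => ?_
  rw [history, Function.update_self, C.history_congr j z t (Nat.le_of_succ_le ht)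
    (g := Function.update g ⟨t, ht⟩ x) (g' := g)]
  intro i hi
  exact Function.update_of_ne (fun h => hi.ne (congrArg Fin.val h)) _ _

lemma measurable_lintegral_advance (hloss : ∀ i, Measurable (C.loss i)) (j : Fin M)
    (t : Fin C.rounds) (z : EuclideanSpace ℝ (Fin d))
    {F : State d M × (Fin C.rounds → ℝ) → ℝ≥0∞} (hF : Measurable F) :
    Measurable fun w => ∫⁻ x, F (C.advance j t z x w) ∂gaussianReal 0 1 := by
  refine Measurable.lintegral_prod_right' (f := fun p : (State d M × (Fin C.rounds → ℝ)) × ℝ =>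
    F (C.advance j t z p.2 p.1)) ?_
  have h := hF.comp ((C.measurable_advance hloss j t).comp
    (measurable_const (a := z).prodMk (measurable_snd.prodMk measurable_fst)))
  exact h

lemma measurable_post_apply (m : Fin M) :
    Measurable fun w : State d M × (Fin C.rounds → ℝ) => ENNReal.ofReal (w.1.post m) :=
  ((measurable_pi_apply m).comp (measurable_post.comp measurable_fst)).ennreal_ofReal

/-- Given the history, the secret index is distributed according to the posterior. -/
lemma sum_lintegral_history [NeZero M] (hloss : ∀ i, Measurable (C.loss i))
    (hbudget : 0 < C.budget) (z : Fin C.rounds → EuclideanSpace ℝ (Fin d)) (t : ℕ)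
    (ht : t ≤ C.rounds) {F : Fin M → State d M × (Fin C.rounds → ℝ) → ℝ≥0∞}
    (hF : ∀ m, Measurable (F m)) :
    ∑ j, ∫⁻ g, F j (C.history j z g t ht) ∂Measure.pi (fun _ => gaussianReal 0 1) =
      ∑ k, ∫⁻ g, ∑ m, ENNReal.ofReal ((C.history k z g t ht).1.post m) *
        F m (C.history k z g t ht) ∂Measure.pi (fun _ => gaussianReal 0 1) := by
  induction t generalizing F with
  | zero =>
    have hM : (0 : ℝ) < M := by exact_mod_cast Nat.pos_of_ne_zero (NeZero.ne M)
    simp only [history, lintegral_const, measure_univ, mul_one, Finset.sum_const,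
      Finset.card_univ, Fintype.card_fin, ← Finset.mul_sum, nsmul_eq_mul, ← mul_assoc]
    rw [one_div, ENNReal.ofReal_inv_of_pos hM, ENNReal.ofReal_natCast, ENNReal.mul_inv_cancel
      (by exact_mod_cast NeZero.ne M) (by simp), one_mul]
  | succ t ih =>
    have ht' := Nat.le_of_succ_le ht
    have hG : Measurable fun w : State d M × (Fin C.rounds → ℝ) =>
        ∑ m, ENNReal.ofReal (w.1.post m) * F m w :=
      Finset.measurable_fun_sum _ fun m _ => (measurable_post_apply m).mul (hF m)
    calc ∑ j, ∫⁻ g, F j (C.history j z g (t + 1) ht) ∂Measure.pi (fun _ => gaussianReal 0 1)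
        = ∑ j, ∫⁻ g, ∫⁻ x, F j (C.advance j ⟨t, ht⟩ (z ⟨t, ht⟩) x (C.history j z g t ht'))
            ∂gaussianReal 0 1 ∂Measure.pi (fun _ => gaussianReal 0 1) :=
          Finset.sum_congr rfl fun j _ => lintegral_history_succ hloss j z t ht (hF j)
      -- The induction hypothesis replaces the true index by one drawn from the posterior, the
      -- setting of the one-step Bayes rule.
      _ = ∑ k, ∫⁻ g, ∑ m, ENNReal.ofReal ((C.history k z g t ht').1.post m) *
            ∫⁻ x, F m (C.advance m ⟨t, ht⟩ (z ⟨t, ht⟩) x (C.history k z g t ht'))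
            ∂gaussianReal 0 1 ∂Measure.pi (fun _ => gaussianReal 0 1) :=
          ih ht' (F := fun j w => ∫⁻ x, F j (C.advance j ⟨t, ht⟩ (z ⟨t, ht⟩) x w) ∂gaussianReal 0 1)
            fun m => measurable_lintegral_advance hloss m ⟨t, ht⟩ _ (hF m)
      _ = ∑ k, ∫⁻ g, ∑ l, ENNReal.ofReal ((C.history k z g t ht').1.post l) *
            ∫⁻ x, ∑ m, ENNReal.ofReal ((C.advance l ⟨t, ht⟩ (z ⟨t, ht⟩) x
              (C.history k z g t ht')).1.post m) *
              F m (C.advance l ⟨t, ht⟩ (z ⟨t, ht⟩) x (C.history k z g t ht'))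
            ∂gaussianReal 0 1 ∂Measure.pi (fun _ => gaussianReal 0 1) :=
          Finset.sum_congr rfl fun k _ => lintegral_congr fun g =>
            Valid.sum_lintegral_advance hloss (t := ⟨t, ht⟩)
              (valid_history hbudget k z g t ht') _ hF
      -- The induction hypothesis read backwards: the index `l`, drawn from the old posterior, is
      -- again the true one.
      _ = ∑ k, ∫⁻ g, ∫⁻ x, ∑ m, ENNReal.ofReal ((C.advance k ⟨t, ht⟩ (z ⟨t, ht⟩) x
              (C.history k z g t ht')).1.post m) *
              F m (C.advance k ⟨t, ht⟩ (z ⟨t, ht⟩) x (C.history k z g t ht'))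
            ∂gaussianReal 0 1 ∂Measure.pi (fun _ => gaussianReal 0 1) :=
          (ih ht' (F := fun l w => ∫⁻ x, ∑ m, ENNReal.ofReal ((C.advance l ⟨t, ht⟩ (z ⟨t, ht⟩) x
              w).1.post m) * F m (C.advance l ⟨t, ht⟩ (z ⟨t, ht⟩) x w) ∂gaussianReal 0 1)
            fun m => measurable_lintegral_advance hloss m ⟨t, ht⟩ _ hG).symm
      _ = _ := Finset.sum_congr rfl fun k _ => (lintegral_history_succ hloss k z t ht hG).symm

lemma measurable_entropy_add_used :
    Measurable fun w : State d M × (Fin C.rounds → ℝ) =>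
      ENNReal.ofReal (entropy w.1.post + w.1.used) :=
  ((measurable_entropy.comp (measurable_post.comp measurable_fst)).add
    (measurable_used.comp measurable_fst)).ennreal_ofReal

/-- The mean of the posterior entropy and of the consumed budget is conserved. -/
lemma sum_lintegral_entropy_history [NeZero M] (hloss : ∀ i, Measurable (C.loss i))
    (hbudget : 0 < C.budget) (z : Fin C.rounds → EuclideanSpace ℝ (Fin d)) (t : ℕ)
    (ht : t ≤ C.rounds) :
    ∑ j, ∫⁻ g, ENNReal.ofReal (entropy (C.history j z g t ht).1.post +
        (C.history j z g t ht).1.used) ∂Measure.pi (fun _ => gaussianReal 0 1) =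
      M * ENNReal.ofReal (Real.log M) := by
  induction t with
  | zero =>
    have hM : (M : ℝ) ≠ 0 := by exact_mod_cast NeZero.ne M
    simp [history, entropy, Real.negMulLog, hM]
  | succ t ih =>
    have ht' := Nat.le_of_succ_le ht
    rw [← ih ht']
    calc ∑ j, ∫⁻ g, ENNReal.ofReal (entropy (C.history j z g (t + 1) ht).1.post +
          (C.history j z g (t + 1) ht).1.used) ∂Measure.pi (fun _ => gaussianReal 0 1)
        = ∑ j, ∫⁻ g, ∫⁻ x, ENNReal.ofReal (entropy
            (C.advance j ⟨t, ht⟩ (z ⟨t, ht⟩) x (C.history j z g t ht')).1.post +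
            (C.advance j ⟨t, ht⟩ (z ⟨t, ht⟩) x (C.history j z g t ht')).1.used)
            ∂gaussianReal 0 1 ∂Measure.pi (fun _ => gaussianReal 0 1) :=
          Finset.sum_congr rfl fun j _ => lintegral_history_succ hloss j z t ht
            measurable_entropy_add_used
      -- Conservation over one step holds only on average over the posterior, so the true index is
      -- first replaced by a posterior draw.
      _ = ∑ k, ∫⁻ g, ∑ m, ENNReal.ofReal ((C.history k z g t ht').1.post m) *
            ∫⁻ x, ENNReal.ofReal (entropy
            (C.advance m ⟨t, ht⟩ (z ⟨t, ht⟩) x (C.history k z g t ht')).1.post +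
            (C.advance m ⟨t, ht⟩ (z ⟨t, ht⟩) x (C.history k z g t ht')).1.used)
            ∂gaussianReal 0 1 ∂Measure.pi (fun _ => gaussianReal 0 1) :=
          sum_lintegral_history hloss hbudget z t ht' (F := fun j w => ∫⁻ x, ENNReal.ofReal
            (entropy (C.advance j ⟨t, ht⟩ (z ⟨t, ht⟩) x w).1.post +
            (C.advance j ⟨t, ht⟩ (z ⟨t, ht⟩) x w).1.used) ∂gaussianReal 0 1)
            fun m => measurable_lintegral_advance hloss m ⟨t, ht⟩ _ measurable_entropy_add_used
      _ = _ := Finset.sum_congr rfl fun k _ => lintegral_congr fun g =>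
          Valid.sum_lintegral_entropy_advance (t := ⟨t, ht⟩) (valid_history hbudget k z g t ht') _

end Config

/-! ### Divergence from a density, and entropy. -/

lemma klDiv_withDensity_left {α : Type*} [MeasurableSpace α] {ν : Measure α} [IsFiniteMeasure ν]
    {f : α → ℝ≥0∞} (hf : Measurable f) [IsFiniteMeasure (ν.withDensity f)] :
    InformationTheory.klDiv (ν.withDensity f) ν =
      ∫⁻ x, ENNReal.ofReal (InformationTheory.klFun (f x).toReal) ∂ν := by
  rw [InformationTheory.klDiv_eq_lintegral_klFun_of_ac (withDensity_absolutelyContinuous _ _)]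
  refine lintegral_congr_ae ?_
  filter_upwards [Measure.rnDeriv_withDensity ν hf] with x hx
  rw [hx]

/-- The divergence of `p` from the uniform law; the affine part of `klFun` cancels because both laws
have mass one. -/
lemma sum_klFun_eq {M : ℕ} [NeZero M] {p : Fin M → ℝ} (hp : IsPosProb p) :
    ∑ m, (M : ℝ)⁻¹ * InformationTheory.klFun (M * p m) = Real.log M - entropy p := by
  have hM : (M : ℝ) ≠ 0 := by exact_mod_cast NeZero.ne M
  have h : ∀ m, (M : ℝ)⁻¹ * InformationTheory.klFun (M * p m) =
      p m * Real.log M - Real.negMulLog (p m) + (M : ℝ)⁻¹ - p m := fun m => by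
    rw [InformationTheory.klFun_apply, Real.log_mul hM (hp.pos m).ne', Real.negMulLog]
    field_simp
    ring
  simp only [h, Finset.sum_sub_distrib, Finset.sum_add_distrib, ← Finset.sum_mul, hp.sum_eq,
    entropy]
  simp [hM]

lemma IsPosProb.entropy_le_log {M : ℕ} [NeZero M] {p : Fin M → ℝ} (hp : IsPosProb p) :
    entropy p ≤ Real.log M := by
  rw [← sub_nonneg, ← sum_klFun_eq hp]
  exact Finset.sum_nonneg fun m _ => mul_nonneg (by positivity)
    (InformationTheory.klFun_nonneg (mul_nonneg (by positivity) (hp.pos m).le))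

/-! ### The joint law of the secret index and the transcript. -/

namespace Config

variable {d N M : ℕ} {C : Config d N M}

instance [NeZero M] : IsProbabilityMeasure (uniformOn (Set.univ : Set (Fin M))) :=
  isProbabilityMeasure_uniformOn Set.finite_univ Set.univ_nonempty

instance [NeZero M] : IsProbabilityMeasure C.randomnessLaw := by
  unfold randomnessLaw; infer_instance

lemma lintegral_uniformOn [NeZero M] (F : Fin M → ℝ≥0∞) :
    ∫⁻ j, F j ∂uniformOn (Set.univ : Set (Fin M)) = (M : ℝ≥0∞)⁻¹ * ∑ j, F j := by
  have h : ∀ j : Fin M, uniformOn (Set.univ : Set (Fin M)) {j} = (M : ℝ≥0∞)⁻¹ := fun j => by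
    rw [uniformOn_univ]; simp
  simp only [lintegral_fintype, h, Finset.mul_sum, mul_comm (F _)]

lemma lintegral_randomnessLaw [NeZero M] {F : Fin M × (Fin C.rounds → EuclideanSpace ℝ (Fin d)) ×
    (Fin C.rounds → ℝ) → ℝ≥0∞} (hF : Measurable F) :
    ∫⁻ ω, F ω ∂C.randomnessLaw = (M : ℝ≥0∞)⁻¹ *
      ∫⁻ z, ∑ j, ∫⁻ g, F (j, z, g) ∂Measure.pi (fun _ => gaussianReal 0 1)
        ∂Measure.pi fun _ => stdGaussian (EuclideanSpace ℝ (Fin d)) := by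
  rw [randomnessLaw, lintegral_prod _ hF.aemeasurable, lintegral_uniformOn,
    lintegral_finsetSum _ fun j _ => Measurable.lintegral_prod_right'
      (f := fun p : (Fin C.rounds → EuclideanSpace ℝ (Fin d)) × (Fin C.rounds → ℝ) => F (j, p))
      (by fun_prop)]
  congr 1
  refine Finset.sum_congr rfl fun j _ => ?_
  rw [lintegral_prod _ (by fun_prop)]

variable (C) in
/-- The directions together with the final state and the released bits. -/
noncomputable def transcript (ω : Fin M × (Fin C.rounds → EuclideanSpace ℝ (Fin d)) ×
    (Fin C.rounds → ℝ)) :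
    (Fin C.rounds → EuclideanSpace ℝ (Fin d)) × State d M × (Fin C.rounds → ℝ) :=
  (ω.2.1, C.history ω.1 ω.2.1 ω.2.2 C.rounds le_rfl)

lemma measurable_transcript (hloss : ∀ i, Measurable (C.loss i)) : Measurable C.transcript := by
  refine measurable_from_prod_countable_right fun j => ?_
  have h := measurable_fst.prodMk (C.measurable_history hloss j C.rounds le_rfl)
  exact h

variable (C) in
/-- The density of the joint law of the secret index and the transcript. -/
noncomputable def posteriorDensity (p : Fin M × (Fin C.rounds → EuclideanSpace ℝ (Fin d)) ×
    State d M × (Fin C.rounds → ℝ)) : ℝ≥0∞ :=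
  M * ENNReal.ofReal (p.2.2.1.post p.1)

lemma measurable_posteriorDensity : Measurable C.posteriorDensity := by
  refine measurable_from_prod_countable_right fun j => ?_
  have h1 : Measurable fun p : (Fin C.rounds → EuclideanSpace ℝ (Fin d)) ×
      State d M × (Fin C.rounds → ℝ) => p.2 := measurable_snd
  have h := ((measurable_post_apply (C := C) j).comp h1).const_mul (M : ℝ≥0∞)
  exact h

variable [NeZero M]

lemma lintegral_prod_transcript (hloss : ∀ i, Measurable (C.loss i))
    {F : Fin M × (Fin C.rounds → EuclideanSpace ℝ (Fin d)) ×
      State d M × (Fin C.rounds → ℝ) → ℝ≥0∞} (hF : Measurable F) :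
    ∫⁻ p, F p ∂(uniformOn (Set.univ : Set (Fin M))).prod (C.randomnessLaw.map C.transcript) =
      ∫⁻ ω, ∑ m, (M : ℝ≥0∞)⁻¹ * F (m, C.transcript ω) ∂C.randomnessLaw := by
  have hT := measurable_transcript hloss
  rw [lintegral_prod _ hF.aemeasurable, lintegral_uniformOn, Finset.mul_sum,
    lintegral_finsetSum _ fun m _ => by fun_prop]
  refine Finset.sum_congr rfl fun m _ => ?_
  rw [lintegral_map (by fun_prop) hT, lintegral_const_mul _ (by fun_prop)]

/-- Bayes' rule for the run, integrated over the directions and tested against arbitrary `F`. The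
factor `M` in the density is the inverse of the uniform prior. -/
lemma map_prodMk_transcript (hloss : ∀ i, Measurable (C.loss i)) (hbudget : 0 < C.budget) :
    C.randomnessLaw.map (fun ω => (ω.1, C.transcript ω)) =
      ((uniformOn (Set.univ : Set (Fin M))).prod
        (C.randomnessLaw.map C.transcript)).withDensity C.posteriorDensity := by
  have hT := measurable_transcript hloss
  have hD := measurable_posteriorDensity (C := C)
  have hM : (M : ℝ≥0∞) ≠ 0 := by exact_mod_cast NeZero.ne M
  refine Measure.ext_of_lintegral _ fun F hF => ?_
  have hS : Measurable fun p : Fin M × (Fin C.rounds → EuclideanSpace ℝ (Fin d)) ×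
      State d M × (Fin C.rounds → ℝ) => ∑ m, ENNReal.ofReal (p.2.2.1.post m) * F (m, p.2) := by
    refine Finset.measurable_fun_sum _ fun m _ => Measurable.mul ?_ (by fun_prop)
    have h1 : Measurable fun p : Fin M × (Fin C.rounds → EuclideanSpace ℝ (Fin d)) ×
      State d M × (Fin C.rounds → ℝ) => p.2.2 := measurable_snd.snd
    have h := (measurable_post_apply (C := C) m).comp h1
    exact h
  rw [lintegral_map hF (by fun_prop), lintegral_withDensity_eq_lintegral_mul _ hD hF,
    lintegral_prod_transcript hloss (hD.mul hF)]
  have h1 : ∀ ω, ∑ m, (M : ℝ≥0∞)⁻¹ * (C.posteriorDensity * F) (m, C.transcript ω) =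
      ∑ m, ENNReal.ofReal ((C.transcript ω).2.1.post m) * F (m, C.transcript ω) := fun ω => by
    refine Finset.sum_congr rfl fun m _ => ?_
    rw [Pi.mul_apply, posteriorDensity, ← mul_assoc, ← mul_assoc, ENNReal.inv_mul_cancel hM
      (by simp), one_mul]
  simp only [h1]
  have hF' : Measurable fun ω => F (ω.1, C.transcript ω) := by
    have h := hF.comp (measurable_fst.prodMk hT)
    exact h
  have hS' : Measurable fun ω => ∑ m, ENNReal.ofReal ((C.transcript ω).2.1.post m) *
      F (m, C.transcript ω) := by
    have h := hS.comp (measurable_fst.prodMk hT)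
    exact h
  rw [lintegral_randomnessLaw hF', lintegral_randomnessLaw hS']
  congr 1
  refine lintegral_congr fun z => ?_
  have h := sum_lintegral_history hloss hbudget z C.rounds le_rfl (F := fun m w => F (m, z, w))
    fun m => by fun_prop
  exact h

/-- `log M` is the mean of `entropy + used`, and `used` is at most the budget. All identities are
kept additive, and the mean entropy is cancelled at the end. -/
lemma lintegral_log_sub_entropy_le (hloss : ∀ i, Measurable (C.loss i)) (hbudget : 0 < C.budget) :
    ∫⁻ ω, ENNReal.ofReal (Real.log M - entropy (C.transcript ω).2.1.post) ∂C.randomnessLaw ≤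
      ENNReal.ofReal C.budget := by
  have hT := measurable_transcript hloss
  have hv : ∀ ω, C.Valid C.rounds (C.transcript ω).2.1 := fun ω => valid_history hbudget _ _ _ _ _
  have hM : (M : ℝ≥0∞) ≠ 0 := by exact_mod_cast NeZero.ne M
  have hent : Measurable fun ω => entropy (C.transcript ω).2.1.post := by
    have h := (measurable_entropy.comp (measurable_post (d := d) (M := M))).comp hT.snd.fst
    exact h
  have hused : Measurable fun ω => ENNReal.ofReal
      (entropy (C.transcript ω).2.1.post + (C.transcript ω).2.1.used) := by
    have h := (hent.add (measurable_used.comp hT.snd.fst)).ennreal_ofReal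
    exact h
  have h1 : ∫⁻ ω, ENNReal.ofReal (Real.log M - entropy (C.transcript ω).2.1.post)
      ∂C.randomnessLaw + ∫⁻ ω, ENNReal.ofReal (entropy (C.transcript ω).2.1.post)
      ∂C.randomnessLaw = ENNReal.ofReal (Real.log M) := by
    rw [← lintegral_add_right _ hent.ennreal_ofReal]
    have : ∀ ω, ENNReal.ofReal (Real.log M - entropy (C.transcript ω).2.1.post) +
        ENNReal.ofReal (entropy (C.transcript ω).2.1.post) = ENNReal.ofReal (Real.log M) :=
      fun ω => by
        rw [← ENNReal.ofReal_add (sub_nonneg.2 (hv ω).post.entropy_le_log)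
          (hv ω).post.entropy_nonneg, sub_add_cancel]
    simp only [this, lintegral_const, measure_univ, mul_one]
  have h2 : ∫⁻ ω, ENNReal.ofReal (entropy (C.transcript ω).2.1.post + (C.transcript ω).2.1.used)
      ∂C.randomnessLaw = ENNReal.ofReal (Real.log M) := by
    rw [lintegral_randomnessLaw hused]
    have := fun z => sum_lintegral_entropy_history hloss hbudget z C.rounds le_rfl
    simp only [transcript, this, lintegral_const, measure_univ, mul_one]
    rw [← mul_assoc, ENNReal.inv_mul_cancel hM (by simp), one_mul]
  have h3 : ∫⁻ ω, ENNReal.ofReal (entropy (C.transcript ω).2.1.post + (C.transcript ω).2.1.used)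
      ∂C.randomnessLaw ≤ ENNReal.ofReal C.budget +
        ∫⁻ ω, ENNReal.ofReal (entropy (C.transcript ω).2.1.post) ∂C.randomnessLaw := by
    have : ENNReal.ofReal C.budget = ∫⁻ _ω, ENNReal.ofReal C.budget ∂C.randomnessLaw := by simp
    rw [this, ← lintegral_add_left measurable_const]
    refine lintegral_mono fun ω => ?_
    rw [← ENNReal.ofReal_add hbudget.le (hv ω).post.entropy_nonneg, add_comm C.budget]
    exact ENNReal.ofReal_le_ofReal (add_le_add_right (hv ω).used_le _)
  -- The cancellation requires a finite mean entropy; it is at most `log M`.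
  have hfin : ∫⁻ ω, ENNReal.ofReal (entropy (C.transcript ω).2.1.post) ∂C.randomnessLaw ≠ ∞ :=
    ne_top_of_le_ne_top ENNReal.ofReal_ne_top (le_add_self.trans h1.le)
  rw [h2, ← h1] at h3
  exact (ENNReal.add_le_add_iff_right hfin).1 h3

/-- The mutual information of the secret index and the whole transcript. -/
lemma klDiv_transcript_le (hloss : ∀ i, Measurable (C.loss i)) (hbudget : 0 < C.budget) :
    InformationTheory.klDiv (C.randomnessLaw.map (fun ω => (ω.1, C.transcript ω)))
      ((uniformOn (Set.univ : Set (Fin M))).prod (C.randomnessLaw.map C.transcript)) ≤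
      ENNReal.ofReal C.budget := by
  have hT := measurable_transcript hloss
  have hD := measurable_posteriorDensity (C := C)
  have hv : ∀ ω, C.Valid C.rounds (C.transcript ω).2.1 := fun ω => valid_history hbudget _ _ _ _ _
  have hmap := map_prodMk_transcript hloss hbudget
  have : IsProbabilityMeasure (C.randomnessLaw.map C.transcript) :=
    Measure.isProbabilityMeasure_map hT.aemeasurable
  have : IsFiniteMeasure (((uniformOn (Set.univ : Set (Fin M))).prod
        (C.randomnessLaw.map C.transcript)).withDensity C.posteriorDensity) := by
    rw [← hmap]; infer_instance
  rw [hmap, klDiv_withDensity_left hD, lintegral_prod_transcript hloss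
    (F := fun p => ENNReal.ofReal (InformationTheory.klFun (C.posteriorDensity p).toReal))
    (InformationTheory.measurable_klFun.comp hD.ennreal_toReal).ennreal_ofReal]
  -- For each transcript, the sum over `m` is the divergence of the posterior from the uniform law,
  -- that is `log M - entropy`.
  refine le_trans (le_of_eq (lintegral_congr fun ω => ?_))
    (lintegral_log_sub_entropy_le hloss hbudget)
  have hM : (0 : ℝ) < M := by exact_mod_cast Nat.pos_of_ne_zero (NeZero.ne M)
  have hp := (hv ω).post
  rw [← sum_klFun_eq hp, ENNReal.ofReal_sum_of_nonneg fun m _ => mul_nonneg (by positivity)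
    (InformationTheory.klFun_nonneg (mul_nonneg hM.le (hp.pos m).le))]
  refine Finset.sum_congr rfl fun m _ => ?_
  rw [ENNReal.ofReal_mul (by positivity), ENNReal.ofReal_inv_of_pos hM, ENNReal.ofReal_natCast,
    posteriorDensity, ENNReal.toReal_mul, ENNReal.toReal_natCast,
    ENNReal.toReal_ofReal (hp.pos m).le]

end Config

end PACZero

/-! ### Data processing from index and transcript to subset and bits. -/

theorem theorem1 {d N M : ℕ} [NeZero M] (C : PACZero.Config d N M)
    (hloss : ∀ i, Measurable (C.loss i))
    (hsubset : ∀ m, (C.subset m).Nonempty)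
    (hmu : 0 < C.mu) (hclip : 0 < C.clip) (hbudget : 0 < C.budget)
    {Ω : Type*} [MeasurableSpace Ω] (P : Measure Ω) [IsProbabilityMeasure P]
    (J : Ω → Fin M) (Z : Ω → Fin C.rounds → EuclideanSpace ℝ (Fin d))
    (G : Ω → Fin C.rounds → ℝ)
    (hlaw : HasLaw (fun ω => (J ω, Z ω, G ω)) C.randomnessLaw P) :
    AEMeasurable (fun ω => C.bits (J ω) (Z ω) (G ω)) P ∧
    PACZero.mutualInfo (fun ω => C.subset (J ω)) (fun ω => C.bits (J ω) (Z ω) (G ω)) P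
      ≤ ENNReal.ofReal C.budget := by
  have hT := PACZero.Config.measurable_transcript hloss
  have hbits : ∀ ω, (C.transcript ω).2.2 = C.bits ω.1 ω.2.1 ω.2.2 := fun ω =>
    PACZero.Config.history_snd_rounds hbudget _ _ _
  have hY : (fun ω => C.bits (J ω) (Z ω) (G ω)) =
      (fun ω' => (C.transcript ω').2.2) ∘ fun ω => (J ω, Z ω, G ω) := by
    funext ω; exact (hbits (J ω, Z ω, G ω)).symm
  have hX : (fun ω => C.subset (J ω)) =
      (fun ω' => C.subset ω'.1) ∘ fun ω => (J ω, Z ω, G ω) := rfl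
  have hXY : (fun ω => (C.subset (J ω), C.bits (J ω) (Z ω) (G ω))) =
      (fun ω' => (C.subset ω'.1, (C.transcript ω').2.2)) ∘ fun ω => (J ω, Z ω, G ω) := by
    funext ω; exact Prod.ext rfl (hbits (J ω, Z ω, G ω)).symm
  have hs : Measurable C.subset := measurable_of_countable _
  have hV : Measurable fun ω => (C.transcript ω).2.2 := hT.snd.snd
  have hS : Measurable fun ω : Fin M × (Fin C.rounds → EuclideanSpace ℝ (Fin d)) ×
    (Fin C.rounds → ℝ) => C.subset ω.1 := hs.comp measurable_fst
  refine ⟨hY ▸ hV.comp_aemeasurable hlaw.aemeasurable, ?_⟩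
  have hU : C.randomnessLaw.map Prod.fst = uniformOn (Set.univ : Set (Fin M)) := by
    rw [PACZero.Config.randomnessLaw, Measure.map_fst_prod]; simp
  have : IsProbabilityMeasure (C.randomnessLaw.map C.transcript) :=
    Measure.isProbabilityMeasure_map hT.aemeasurable
  have hg : Measurable (Prod.map C.subset fun w : (Fin C.rounds → EuclideanSpace ℝ (Fin d)) ×
    PACZero.State d M × (Fin C.rounds → ℝ) => w.2.2) := hs.prodMap measurable_snd.snd
  have hjoint : P.map (fun ω => (C.subset (J ω), C.bits (J ω) (Z ω) (G ω))) =
      (C.randomnessLaw.map (fun ω => (ω.1, C.transcript ω))).map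
        (Prod.map C.subset fun w => w.2.2) := by
    rw [hXY, ← AEMeasurable.map_map_of_aemeasurable
      (hS.prodMk hV).aemeasurable hlaw.aemeasurable,
      hlaw.map_eq, Measure.map_map hg (measurable_fst.prodMk hT)]
    rfl
  -- The map acts on the two coordinates separately, so it also carries the product of the marginals
  -- to the product of the new marginals. It need not be injective: candidate subsets may coincide.
  have hmarg : (P.map fun ω => C.subset (J ω)).prod (P.map fun ω => C.bits (J ω) (Z ω) (G ω)) =
      ((uniformOn (Set.univ : Set (Fin M))).prod (C.randomnessLaw.map C.transcript)).map
        (Prod.map C.subset fun w => w.2.2) := by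
    rw [← Measure.map_prod_map _ _ hs measurable_snd.snd, ← hU, Measure.map_map hs measurable_fst,
      Measure.map_map measurable_snd.snd hT, hX, hY,
      ← AEMeasurable.map_map_of_aemeasurable hS.aemeasurable hlaw.aemeasurable,
      ← AEMeasurable.map_map_of_aemeasurable hV.aemeasurable hlaw.aemeasurable, hlaw.map_eq]
    rfl
  rw [PACZero.mutualInfo, hjoint, hmarg]
  exact (InformationTheory.klDiv_map_le _ _ hg).trans
    (PACZero.Config.klDiv_transcript_le hloss hbudget)
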